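/- Let $0<|q|<1$, $x\in\mathbb C\setminus\{0\}$. Write $(x;q)_n=\prod_{i=0}^{n-1}(1-xq^i)$, $(x;q)_\infty=\prod_{i\ge 0}(1-xq^i)$, $(q)_\infty=(q;q)_\infty$, $\Theta(x;q)=(x;q)_\infty(q/x;q)_\infty(q;q)_\infty$, $$m(x,z;q)=\frac1{\Theta(z;q)}\sum_{r\in\mathbb Z}\frac{(-1)^rq^{\binom r2}z^r}{1-q^{r-1}xz},\qquad f_{a,b,c}(x,y;q)=\sum_{r,s\in\mathbb Z}\frac{\operatorname{sg}(r)+\operatorname{sg}(s)}2(-1)^{r+s}x^ry^sq^{a\binom r2+brs+c\binom s2},$$ where $\operatorname{sg}(r)=1$ for $r\ge 0$ and $\operatorname{sg}(r)=-1$ for $r<0$, and $$g(x;q)=x^{-1}\Big(-1+\sum_{n\ge0}\frac{q^{n^2}}{(x;q)_{n+1}(q/x;q)_n}\Big).$$ (1) Suppose that $x^3\ne -q^{3k}$ and $x^2\neq -q^k$ for all $k\in\mathbb Z$ (so that no denominator below vanishes). Then all series below converge absolutely and $$\begin{aligned} f_{1,2,3}(x^{-1}q^2,q^3;q)={}&x^{-1}m(x^{-3}q^2,-x^3;q^3)(q)_\infty+x^{-2}m(x^{-3}q,-x^3;q^3)(q)_\infty-x^{-1}\Theta(x;q)\,m(qx^{-2},-1;q)\\&-\frac{(q^2;q^2)_\infty^3\,\Theta(q;q^2)\,\Theta(-x;q)\,\Theta(x^{-3};q^3)}{\Theta(-1;q^2)\,\Theta(-q;q^2)\,\Theta(-x^3;q^3)\,\Theta(-x^{-2};q)}.\end{aligned}$$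 (2) Modulo theta functions, $$f_{1,2,3}(x^{-1}q^2,q^3;q)\sim-(q)_\infty\,g(x;q)-x^{-1}\Theta(x;q)\,m(qx^{-2},-1;q).$$ That is, there is a finite sum of theta quotients, i.e. of expressions $c\,x^iq^j\prod_l\Theta(\varepsilon_lx^{a_l}q^{b_l};q^{m_l})^{\pm1}$ with $c\in\mathbb C$, $\varepsilon_l=\pm1$, integers $i,j,a_l,b_l$ and $m_l\ge1$, all of them independent of $x$ and $q$, such that for all $(x,q)$ as in (1) with in addition $x\ne q^k$ for all $k\in\mathbb Z$, the series defining $g(x;q)$ converges absolutely, no theta function in a denominator of the sum vanishes, and the difference of the two sides equals the sum. -/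

import Mathlib

noncomputable section

namespace MockTheta

/-- The finite `q`-Pochhammer symbol `(x;q)_n = ∏_{i=0}^{n-1} (1 - x q^i)`. -/
def qPoch (x q : ℂ) (n : ℕ) : ℂ := ∏ i ∈ Finset.range n, (1 - x * q ^ i)

/-- The infinite `q`-Pochhammer symbol `(x;q)_∞ = ∏_{i ≥ 0} (1 - x q^i)`, for `|q| < 1`. -/
def qPochInf (x q : ℂ) : ℂ := ∏' i : ℕ, (1 - x * q ^ i)

/-- The product defining `(x;q)_∞` converges for `|q| < 1`. -/
theorem multipliable_qPochInf (x q : ℂ) (hq : ‖q‖ < 1) :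
    Multipliable (fun i : ℕ => 1 - x * q ^ i) := by
  have h : Summable (fun i : ℕ => ‖-(x * q ^ i)‖) := by
    simpa [norm_mul, norm_pow] using
      (summable_geometric_of_lt_one (norm_nonneg q) hq).mul_left ‖x‖
  simpa [sub_eq_add_neg] using multipliable_one_add_of_summable h

/-- The theta function `Θ(x;q) = (x;q)_∞ (q/x;q)_∞ (q;q)_∞`. -/
def theta (x q : ℂ) : ℂ := qPochInf x q * qPochInf (q / x) q * qPochInf q q

/-- `sg(r) = 1` for `r ≥ 0` and `sg(r) = -1` for `r < 0`. -/
def sg (r : ℤ) : ℂ := if 0 ≤ r then 1 else -1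

/-- `sg(r,s) = (sg(r) + sg(s)) / 2`. -/
def sg₂ (r s : ℤ) : ℂ := (sg r + sg s) / 2

/-- `r(r-1)/2` for an integer `r`; the integer division is exact. -/
def binom2 (r : ℤ) : ℤ := r * (r - 1) / 2

/-- The general term of the Hecke-type double sum. -/
def heckeTerm (a b c : ℤ) (x y q : ℂ) (p : ℤ × ℤ) : ℂ :=
  sg₂ p.1 p.2 * (-1) ^ (p.1 + p.2) * x ^ p.1 * y ^ p.2 *
    q ^ (a * binom2 p.1 + b * p.1 * p.2 + c * binom2 p.2)

/-- The Hecke-type double sum `f_{a,b,c}(x,y;q)`. -/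
def hecke (a b c : ℤ) (x y q : ℂ) : ℂ := ∑' p : ℤ × ℤ, heckeTerm a b c x y q p

/-- The general term of the series in the Appell function. -/
def appellTerm (x z q : ℂ) (r : ℤ) : ℂ :=
  (-1) ^ r * q ^ binom2 r * z ^ r / (1 - q ^ (r - 1) * x * z)

/-- The Appell function `m(x,z;q)`. -/
def appell (x z q : ℂ) : ℂ := (1 / theta z q) * ∑' r : ℤ, appellTerm x z q r

/-- The general term of the series in the universal mock theta function. -/
def umtTerm (x q : ℂ) (n : ℕ) : ℂ :=
  q ^ (n ^ 2) / (qPoch x q (n + 1) * qPoch (q / x) q n)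

/-- The universal mock theta function
`g(x;q) = x⁻¹ (-1 + ∑_{n ≥ 0} q^{n²} / ((x;q)_{n+1} (q/x;q)_n))`. -/
def umt (x q : ℂ) : ℂ := x⁻¹ * (-1 + ∑' n : ℕ, umtTerm x q n)

/-- Formal data `(ε, a, b, m)` of a theta function `Θ(ε x^a q^b; q^m)`, with `ε = ±1`,
integers `a`, `b` and `m ≥ 1`.  (The choice `a = 0`, `ε = 1`, `b = m'`, `m = 3 m'`
gives `(q^{m'}; q^{m'})_∞`.) -/
structure ThetaFactor where
  ε : ℤˣ
  a : ℤ
  b : ℤ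
  m : ℕ
  m_pos : 0 < m

/-- The value `Θ(ε x^a q^b; q^m)`. -/
def ThetaFactor.eval (t : ThetaFactor) (x q : ℂ) : ℂ :=
  theta (((t.ε : ℤ) : ℂ) * x ^ t.a * q ^ t.b) (q ^ t.m)

/-- Formal data of a theta quotient: a constant times a monomial in `x`, `q` times a product of
theta functions divided by a product of theta functions. -/
structure ThetaQuotient where
  coeff : ℂ
  i : ℤ
  j : ℤ
  num : List ThetaFactor
  den : List ThetaFactor

/-- The value of a theta quotient at `(x, q)`. -/
def ThetaQuotient.eval (t : ThetaQuotient) (x q : ℂ) : ℂ :=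
  t.coeff * x ^ t.i * q ^ t.j * (t.num.map fun d => d.eval x q).prod /
    (t.den.map fun d => d.eval x q).prod

/-- `F` and `G`, functions of `(x, q)`, are equivalent modulo theta functions on the domain `D`:
their difference is a finite sum of theta quotients (the same for all `(x, q)`),
no denominator of which vanishes at a point of `D`. -/
def EquivModTheta (D : Set (ℂ × ℂ)) (F G : ℂ → ℂ → ℂ) : Prop :=
  ∃ L : List ThetaQuotient, ∀ x q : ℂ, (x, q) ∈ D →
    (∀ t ∈ L, ∀ d ∈ t.den, d.eval x q ≠ 0) ∧
      F x q - G x q = (L.map fun t => t.eval x q).sum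

/-- The pairs `(x, q)` with `0 < |q| < 1`, `x ≠ 0` at which neither `Θ(-x³;q³)` nor
`Θ(-x⁻²;q)` vanishes. -/
def genericDomain : Set (ℂ × ℂ) :=
  {p | 0 < ‖p.2‖ ∧ ‖p.2‖ < 1 ∧ p.1 ≠ 0 ∧
    (∀ k : ℤ, p.1 ^ 3 ≠ -p.2 ^ (3 * k)) ∧ (∀ k : ℤ, p.1 ^ 2 ≠ -p.2 ^ k)}

/-- The points of `genericDomain` that are not poles of `g(x;q)`. -/
def genericDomainUmt : Set (ℂ × ℂ) :=
  {p | p ∈ genericDomain ∧ ∀ k : ℤ, p.1 ≠ p.2 ^ k}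

end MockTheta

end

/-! Both identities are proved by counting zeros on the punctured plane modulo `q`. Multiplying by
every theta function in a denominator, and moving all terms to one side, gives a function `E` of `x`
that is holomorphic off `0` and satisfies `E(qx) = c x^(-n) E(x)`. If `E` is not zero, it has at
most `n` zeros modulo `q^ℤ`: each zero `a` can be divided out by `Θ(x/a;q)`, which lowers `n` by
one, and Liouville's theorem excludes negative `n`. So `n + 1` inequivalent zeros suffice
(`eq_zero_of_zeros`).

The quasi-periodicity of `E` comes from matching inhomogeneous terms. In `hecke_q_mul` the double
sum picks up `(q)_∞ (x + x²)`, which the two Appell functions in base `q³` also produce, and `(1 -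
x²) Θ(x;q)`, which `m(qx⁻²,-1;q)` accounts for. For `g` the functional equation comes from a
telescoping sum (`thetaUmt_q_mul`).

The zeros are found where a cleared denominator vanishes. At `x³ = -1` the Appell sums in base `q³`
are evaluated at `z = 1`, where the partial fraction expansion of `1/Θ` makes them products
(`appellSum_one`); at `x² = -1` only a residue of the third Appell sum survives. For the double sum
`n = 4`, and the zeros are the three cube roots of `-1` and `±i` (`hecke_expansion`). For `g` one
has `n = 1`, and the two nonreal cube roots of `-1` suffice (`umt_expansion`).

Both expansions contain the same pair of Appell functions in base `q³`. Eliminating it leaves two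
explicit theta quotients, which is the equivalence modulo theta functions. -/

noncomputable section

namespace MockTheta

open Filter Topology

/-! ### Triangular numbers and convergence of theta-like series -/

theorem two_mul_binom2 (r : ℤ) : 2 * binom2 r = r * (r - 1) := by
  unfold binom2
  exact Int.mul_ediv_cancel' (Int.even_mul_pred_self r).two_dvd

theorem binom2_add_one (r : ℤ) : binom2 (r + 1) = binom2 r + r := by
  have h1 := two_mul_binom2 r
  have h2 := two_mul_binom2 (r + 1)
  nlinarith

theorem binom2_neg (r : ℤ) : binom2 (-r) = binom2 r + r := by
  have h1 := two_mul_binom2 r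
  have h2 := two_mul_binom2 (-r)
  nlinarith

theorem binom2_add (r s : ℤ) : binom2 (r + s) = binom2 r + binom2 s + r * s := by
  have h1 := two_mul_binom2 r
  have h2 := two_mul_binom2 s
  have h3 := two_mul_binom2 (r + s)
  nlinarith

@[simp] theorem binom2_zero : binom2 0 = 0 := rfl

@[simp] theorem binom2_one : binom2 1 = 0 := rfl

theorem summable_nat_gauss {ρ : ℝ} (h0 : 0 < ρ) (h1 : ρ < 1) {R : ℝ} (hR : 0 < R) :
    Summable fun n : ℕ => ρ ^ binom2 n * R ^ n := by
  refine summable_of_ratio_test_tendsto_lt_one (l := 0) one_pos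
    (Eventually.of_forall fun n => by positivity) ?_
  have : (fun n : ℕ => ‖ρ ^ binom2 (n + 1 : ℕ) * R ^ (n + 1)‖ / ‖ρ ^ binom2 n * R ^ n‖)
      = fun n : ℕ => ρ ^ n * R := by
    funext n
    rw [Real.norm_of_nonneg (by positivity), Real.norm_of_nonneg (by positivity)]
    push_cast
    rw [binom2_add_one, zpow_add₀ h0.ne', pow_succ, zpow_natCast]
    field_simp
  rw [this]
  simpa using (tendsto_pow_atTop_nhds_zero_of_lt_one h0.le h1).mul_const R

/-- The series `∑ ρ^{r(r-1)/2} R^r` over the integers converges. -/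
theorem summable_gauss {ρ : ℝ} (h0 : 0 < ρ) (h1 : ρ < 1) {R : ℝ} (hR : 0 < R) :
    Summable fun r : ℤ => ρ ^ binom2 r * R ^ r := by
  refine Summable.of_nat_of_neg (by simpa using summable_nat_gauss h0 h1 hR) ?_
  refine (summable_nat_gauss h0 h1 (div_pos h0 hR)).congr fun n => ?_
  rw [binom2_neg, zpow_add₀ h0.ne', zpow_natCast, zpow_neg, zpow_natCast, div_pow]
  field_simp

theorem summable_gauss_abs {ρ : ℝ} (h0 : 0 < ρ) (h1 : ρ < 1) {R : ℝ} (hR : 0 < R) :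
    Summable fun r : ℤ => ρ ^ binom2 r * (R ^ r + (R⁻¹) ^ r) := by
  simpa [mul_add] using (summable_gauss h0 h1 hR).add (summable_gauss h0 h1 (inv_pos.2 hR))

/-- Gives one majorant for all `r`, of either sign, valid on a whole annulus, as locally uniform
convergence of the bilateral series requires. -/
theorem zpow_le_add_inv {t R : ℝ} (ht : R⁻¹ ≤ t) (hR : 0 < R) (htR : t ≤ R) (r : ℤ) :
    t ^ r ≤ R ^ r + (R⁻¹) ^ r := by
  have h0 : 0 < t := (inv_pos.2 hR).trans_le ht
  rcases le_total 0 r with h | h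
  · exact (zpow_le_zpow_left₀ h h0.le htR).trans (le_add_of_nonneg_right (by positivity))
  · refine le_trans ?_ (le_add_of_nonneg_left (by positivity))
    lift -r to ℕ using by omega with n hn
    obtain rfl : r = -n := by omega
    rw [zpow_neg, zpow_neg, ← inv_zpow, ← inv_zpow, inv_inv]
    exact zpow_le_zpow_left₀ (by positivity) (by positivity) ((inv_le_comm₀ h0 hR).2 ht)

/-- Every nonzero complex number has a neighbourhood on which `R⁻¹ ≤ ‖x‖ ≤ R`. -/
theorem exists_annulus_nhds {x : ℂ} (hx : x ≠ 0) :
    ∃ R : ℝ, 0 < R ∧ ∃ U : Set ℂ, IsOpen U ∧ x ∈ U ∧ U ⊆ {0}ᶜ ∧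
      ∀ y ∈ U, R⁻¹ ≤ ‖y‖ ∧ ‖y‖ ≤ R := by
  have hx' : 0 < ‖x‖ := norm_pos_iff.2 hx
  set R := ‖x‖ + ‖x‖⁻¹ + 1
  have hR : 0 < R := by positivity
  have h1 : R⁻¹ < ‖x‖ := by
    rw [inv_lt_comm₀ hR hx']; simp only [R]; linarith
  have h2 : ‖x‖ < R := by
    have : 0 < ‖x‖⁻¹ := by positivity
    simp only [R]; linarith
  refine ⟨R, hR, {y | R⁻¹ < ‖y‖ ∧ ‖y‖ < R}, ?_, ⟨h1, h2⟩, ?_, fun y hy => ⟨hy.1.le, hy.2.le⟩⟩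
  · exact (isOpen_lt continuous_const continuous_norm).inter
      (isOpen_lt continuous_norm continuous_const)
  · rintro y ⟨hy, -⟩ rfl
    rw [norm_zero] at hy
    exact absurd hy (inv_pos.2 hR).not_gt

theorem isOpen_ne_zero : IsOpen ({0}ᶜ : Set ℂ) := isOpen_compl_singleton

/-- Locally, a series of holomorphic functions whose terms are eventually dominated by a summable
sequence is holomorphic. -/
theorem differentiableOn_tsum_of_eventually {ι : Type*} {f : ι → ℂ → ℂ} {U : Set ℂ} {u : ι → ℝ}
    (hU : IsOpen U) (hu : Summable u) (hf : ∀ i, DifferentiableOn ℂ (f i) U)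
    (hb : ∀ᶠ i in cofinite, ∀ w ∈ U, ‖f i w‖ ≤ u i) :
    DifferentiableOn ℂ (fun w => ∑' i, f i w) U := by
  classical
  set S : Set ι := {i | ¬ ∀ w ∈ U, ‖f i w‖ ≤ u i}
  have hS : S.Finite := hb
  have key : ∀ w ∈ U, ∑' i, f i w
      = ∑ i ∈ hS.toFinset, f i w + ∑' i : {i // i ∉ hS.toFinset}, f i w := by
    intro w hw
    refine (Summable.sum_add_tsum_compl ?_).symm
    refine Summable.of_norm_bounded_eventually hu ?_
    filter_upwards [hb] with i hi using hi w hw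
  refine DifferentiableOn.congr (DifferentiableOn.add
    (DifferentiableOn.fun_sum fun i _ => hf i) ?_) key
  refine Complex.differentiableOn_tsum_of_summable_norm (hu.subtype _) (fun i => hf i) hU ?_
  rintro ⟨i, hi⟩ w hw
  have : i ∉ S := by simpa using hi
  exact (not_not.1 this) w hw

/-- Two functions continuous off `0` that agree off a countable set agree off `0`. -/
theorem eqOn_of_countable {f g : ℂ → ℂ} {S : Set ℂ} (hS : S.Countable)
    (hf : ContinuousOn f {0}ᶜ) (hg : ContinuousOn g {0}ᶜ)
    (h : ∀ x, x ≠ 0 → x ∉ S → f x = g x) {x : ℂ} (hx : x ≠ 0) : f x = g x := by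
  have hd : Dense (Sᶜ ∩ {0}ᶜ) := by
    rw [← Set.compl_union]
    exact (hS.union (Set.countable_singleton 0)).dense_compl ℝ
  have : Set.EqOn f g {0}ᶜ := by
    refine Set.EqOn.of_subset_closure (s := Sᶜ ∩ {0}ᶜ) (fun y hy => h y hy.2 hy.1) hf hg
      Set.inter_subset_right ?_
    rw [hd.closure_eq]; exact Set.subset_univ _
  exact this hx

/-! ### Infinite products -/

theorem qPochInf_eq_mul (x : ℂ) {q : ℂ} (hq : ‖q‖ < 1) :
    qPochInf x q = (1 - x) * qPochInf (x * q) q := by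
  have hm : Multipliable (fun i : ℕ => 1 - x * q ^ (i + 1)) := by
    refine (multipliable_qPochInf (x * q) q hq).congr fun i => ?_
    ring
  rw [qPochInf, tprod_eq_zero_mul' (f := fun i : ℕ => 1 - x * q ^ i) hm]
  simp only [pow_zero, mul_one, qPochInf]
  congr 1
  exact tprod_congr fun i => by ring

theorem qPochInf_eq_qPoch_mul (x : ℂ) {q : ℂ} (hq : ‖q‖ < 1) (n : ℕ) :
    qPochInf x q = qPoch x q n * qPochInf (x * q ^ n) q := by
  induction n with
  | zero => simp [qPoch]
  | succ n ih =>
    rw [ih, qPochInf_eq_mul (x * q ^ n) hq, qPoch, qPoch, Finset.prod_range_succ, pow_succ]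
    ring_nf

theorem qPochInf_ne_zero {x q : ℂ} (hq : ‖q‖ < 1) (h : ∀ i : ℕ, x * q ^ i ≠ 1) :
    qPochInf x q ≠ 0 := by
  have := tprod_one_add_ne_zero_of_summable (f := fun i : ℕ => -(x * q ^ i))
    (fun i => by simpa [← sub_eq_add_neg, sub_eq_zero] using (h i).symm)
    (by simpa [norm_mul, norm_pow] using
      (summable_geometric_of_lt_one (norm_nonneg q) hq).mul_left ‖x‖)
  simpa [qPochInf, sub_eq_add_neg] using this

theorem qPochInf_ne_zero_of_norm_lt {x q : ℂ} (hq : ‖q‖ < 1) (hx : ‖x‖ < 1) :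
    qPochInf x q ≠ 0 := by
  refine qPochInf_ne_zero hq fun i h => ?_
  have h1 : ‖x * q ^ i‖ < 1 := by
    rw [norm_mul, norm_pow]
    exact (mul_le_of_le_one_right (norm_nonneg _)
      (pow_le_one₀ (norm_nonneg _) hq.le)).trans_lt hx
  rw [h, norm_one] at h1
  exact lt_irrefl _ h1

@[simp] theorem qPochInf_one {q : ℂ} (hq : ‖q‖ < 1) : qPochInf 1 q = 0 := by
  rw [qPochInf_eq_mul 1 hq]; simp

theorem tendsto_qPoch (x : ℂ) {q : ℂ} (hq : ‖q‖ < 1) :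
    Tendsto (qPoch x q) atTop (𝓝 (qPochInf x q)) :=
  (multipliable_qPochInf x q hq).hasProd.tendsto_prod_nat

theorem differentiable_qPochInf {q : ℂ} (hq : ‖q‖ < 1) :
    Differentiable ℂ fun x => qPochInf x q := by
  intro x
  have hm : HasProdLocallyUniformlyOn (fun (i : ℕ) (x : ℂ) => 1 + -(x * q ^ i))
      (fun x => ∏' i : ℕ, (1 + -(x * q ^ i))) (Metric.ball 0 (‖x‖ + 1)) := by
    refine Summable.hasProdLocallyUniformlyOn_nat_one_add Metric.isOpen_ball
      (u := fun i => (‖x‖ + 1) * ‖q‖ ^ i)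
      ((summable_geometric_of_lt_one (norm_nonneg q) hq).mul_left _)
      (Eventually.of_forall fun n y hy => ?_) (fun n => by fun_prop)
    rw [norm_neg, norm_mul, norm_pow]
    gcongr
    simpa using (Metric.mem_ball.1 hy).le
  have hd := hm.differentiableOn
    (.of_forall fun _ ↦ by simpa [Finset.prod_fn] using
      DifferentiableOn.finsetProd (fun _ _ ↦ by fun_prop)) Metric.isOpen_ball
  have := hd.differentiableAt (x := x) (Metric.isOpen_ball.mem_nhds (by simp))
  simpa [qPochInf, sub_eq_add_neg] using this

theorem exists_norm_qPochInf_le {q : ℂ} (hq : ‖q‖ < 1) (R : ℝ) :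
    ∃ C : ℝ, 0 < C ∧ ∀ x : ℂ, ‖x‖ ≤ R → ‖qPochInf x q‖ ≤ C := by
  obtain ⟨C, hC⟩ := (isCompact_closedBall (0 : ℂ) R).exists_bound_of_continuousOn
    (differentiable_qPochInf hq).continuous.continuousOn
  refine ⟨max C 1, by positivity, fun x hx => (hC x (by simpa using hx)).trans (le_max_left _ _)⟩

/-! ### The theta function -/

/-- The theta function without its zero at `1`. -/
def thetaReg (x q : ℂ) : ℂ := qPochInf (x * q) q * qPochInf (q / x) q * qPochInf q q

theorem theta_eq_mul_thetaReg (x : ℂ) {q : ℂ} (hq : ‖q‖ < 1) :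
    theta x q = (1 - x) * thetaReg x q := by
  rw [theta, qPochInf_eq_mul x hq, thetaReg]; ring

theorem theta_one {q : ℂ} (hq : ‖q‖ < 1) : theta 1 q = 0 := by
  simp [theta_eq_mul_thetaReg _ hq]

theorem thetaReg_one (q : ℂ) : thetaReg 1 q = qPochInf q q ^ 3 := by
  simp [thetaReg]; ring

theorem theta_div (x q : ℂ) (hq0 : q ≠ 0) : theta (q / x) q = theta x q := by
  rw [theta, theta, div_div_cancel₀ hq0]; ring

theorem theta_q_mul {x q : ℂ} (hx : x ≠ 0) (hq0 : q ≠ 0) (hq : ‖q‖ < 1) :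
    theta (q * x) q = -x⁻¹ * theta x q := by
  have e : q / (q * x) = x⁻¹ := by field_simp
  rw [theta, theta, e, qPochInf_eq_mul x hq, qPochInf_eq_mul x⁻¹ hq,
    show x⁻¹ * q = q / x by ring, mul_comm x q]
  have : (1 - x⁻¹) = -x⁻¹ * (1 - x) := by field_simp; ring
  rw [this]; ring

theorem theta_inv {x q : ℂ} (hx : x ≠ 0) (hq0 : q ≠ 0) (hq : ‖q‖ < 1) :
    theta x⁻¹ q = -x⁻¹ * theta x q := by
  rw [← theta_q_mul hx hq0 hq, ← theta_div _ _ hq0]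
  congr 1
  field_simp

theorem theta_zpow_mul {x q : ℂ} (hx : x ≠ 0) (hq0 : q ≠ 0) (hq : ‖q‖ < 1) (r : ℤ) :
    (-1) ^ r * q ^ binom2 r * x ^ r * theta (q ^ r * x) q = theta x q := by
  have step : ∀ r : ℤ, (-1) ^ (r + 1) * q ^ binom2 (r + 1) * x ^ (r + 1) *
      theta (q ^ (r + 1) * x) q = (-1) ^ r * q ^ binom2 r * x ^ r * theta (q ^ r * x) q := by
    intro r
    have h : q ^ (r + 1) * x = q * (q ^ r * x) := by rw [zpow_add_one₀ hq0]; ring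
    rw [h, theta_q_mul (mul_ne_zero (zpow_ne_zero _ hq0) hx) hq0 hq, binom2_add_one,
      zpow_add_one₀ (by norm_num), zpow_add₀ hq0, zpow_add_one₀ hx]
    have := zpow_ne_zero r hq0
    field_simp
  induction r with
  | zero => simp
  | succ n ih => rw [step, ih]
  | pred n ih => rw [← ih, ← step]; simp

theorem thetaReg_ne_zero_of {x q : ℂ} (hq : ‖q‖ < 1) (h1 : ∀ i : ℕ, x * q ^ (i + 1) ≠ 1)
    (h2 : ∀ i : ℕ, q ^ (i + 1) / x ≠ 1) : thetaReg x q ≠ 0 := by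
  refine mul_ne_zero (mul_ne_zero (qPochInf_ne_zero hq fun i => ?_)
    (qPochInf_ne_zero hq fun i => ?_)) (qPochInf_ne_zero_of_norm_lt hq hq)
  · convert! h1 i using 1; ring
  · convert! h2 i using 1; ring

theorem theta_ne_zero {x q : ℂ} (hq : ‖q‖ < 1)
    (h : ∀ k : ℤ, x ≠ q ^ k) : theta x q ≠ 0 := by
  rw [theta_eq_mul_thetaReg x hq]
  refine mul_ne_zero (sub_ne_zero.2 fun h' => h 0 (by simp [← h'])) (thetaReg_ne_zero_of hq ?_ ?_)
  · intro i hi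
    refine h (-(i + 1 : ℕ)) ?_
    rw [zpow_neg, zpow_natCast]
    exact eq_inv_of_mul_eq_one_left hi
  · intro i hi
    refine h (i + 1 : ℕ) ?_
    rw [zpow_natCast]
    exact (eq_of_div_eq_one hi).symm

theorem theta_zpow {q : ℂ} (hq0 : q ≠ 0) (hq : ‖q‖ < 1) (k : ℤ) : theta (q ^ k) q = 0 := by
  have := theta_zpow_mul one_ne_zero hq0 hq k
  rw [theta_one hq, mul_one, one_zpow, mul_one] at this
  simpa [hq0, zpow_ne_zero] using this

theorem differentiableOn_thetaReg {q : ℂ} (hq : ‖q‖ < 1) :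
    DifferentiableOn ℂ (fun x => thetaReg x q) {0}ᶜ := by
  intro x hx
  have hx : x ≠ 0 := hx
  have h := differentiable_qPochInf hq
  refine DifferentiableAt.differentiableWithinAt ?_
  refine (((h _).comp x (f := fun x => x * q) (by fun_prop)).mul
    ((h _).comp x (f := fun x => q / x) (by fun_prop (disch := assumption)))).mul_const _

theorem differentiableOn_theta {q : ℂ} (hq : ‖q‖ < 1) :
    DifferentiableOn ℂ (fun x => theta x q) {0}ᶜ := by
  simp_rw [theta_eq_mul_thetaReg _ hq]
  exact DifferentiableOn.mul (by fun_prop) (differentiableOn_thetaReg hq)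

/-! ### The Jacobi triple product -/

/-- `1 / (q;q)_m`, extended by zero to negative `m`. -/
def invQPoch (q : ℂ) (m : ℤ) : ℂ := if 0 ≤ m then (qPoch q q m.toNat)⁻¹ else 0

theorem one_sub_pow_ne_zero {q : ℂ} (hq : ‖q‖ < 1) (n : ℕ) : 1 - q ^ (n + 1) ≠ 0 := by
  intro h
  have h1 : ‖q ^ (n + 1)‖ < 1 := by
    rw [norm_pow]; exact pow_lt_one₀ (norm_nonneg _) hq (by simp)
  rw [← sub_eq_zero.1 h, norm_one] at h1
  exact lt_irrefl _ h1

/-- With the extension by zero, the recursion holds for every integer: at `m = 0` the factor `1 -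
q^m` vanishes. Sums over `ℤ` then need no boundary cases. -/
theorem invQPoch_sub_one {q : ℂ} (hq : ‖q‖ < 1) (m : ℤ) :
    invQPoch q (m - 1) = (1 - q ^ m) * invQPoch q m := by
  rcases lt_trichotomy m 0 with h | rfl | h
  · rw [invQPoch, invQPoch, if_neg (by omega), if_neg (by omega), mul_zero]
  · simp [invQPoch]
  · obtain ⟨n, rfl⟩ : ∃ n : ℕ, m = n + 1 := ⟨(m - 1).toNat, by omega⟩
    have h1 : ((n : ℤ) + 1).toNat = n + 1 := by omega
    rw [invQPoch, invQPoch, if_pos (by omega), if_pos (by omega), h1, add_sub_cancel_right,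
      Int.toNat_natCast, qPoch, qPoch, Finset.prod_range_succ, mul_inv_rev,
      show (q : ℂ) ^ ((n : ℤ) + 1) = q ^ (n + 1) by norm_cast, ← pow_succ',
      mul_inv_cancel_left₀ (one_sub_pow_ne_zero hq n)]

/-- The coefficients in the finite form of the triple product. -/
def tripleCoeff (q : ℂ) (n : ℕ) (k : ℤ) : ℂ :=
  qPoch q q (2 * n) * (invQPoch q (n - k) * invQPoch q (n + k))

/-- The three terms mirror the new factor `(1 - x q^n)(1 - q^(n+1)/x) = (1 + q^(2n+1)) - x q^n -
q^(n+1)/x` of the finite product. The identity is the `q`-Pascal rule applied twice. -/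
theorem tripleCoeff_succ {q : ℂ} (hq0 : q ≠ 0) (hq : ‖q‖ < 1) (n : ℕ) (k : ℤ) :
    tripleCoeff q (n + 1) k = (1 + q ^ (2 * n + 1)) * tripleCoeff q n k
      + q ^ ((n : ℤ) + 1 - k) * tripleCoeff q n (k - 1)
      + q ^ ((n : ℤ) + 1 + k) * tripleCoeff q n (k + 1) := by
  have a1 := invQPoch_sub_one hq ((n : ℤ) + 1 - k)
  have a2 := invQPoch_sub_one hq ((n : ℤ) - k)
  have b1 := invQPoch_sub_one hq ((n : ℤ) + 1 + k)
  have b2 := invQPoch_sub_one hq ((n : ℤ) + k)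
  have p : qPoch q q (2 * (n + 1)) =
      qPoch q q (2 * n) * (1 - q ^ (2 * n + 1)) * (1 - q ^ (2 * n + 2)) := by
    rw [show 2 * (n + 1) = 2 * n + 1 + 1 by ring, qPoch, qPoch, Finset.prod_range_succ,
      Finset.prod_range_succ, ← pow_succ', ← pow_succ']
  simp only [tripleCoeff, p]
  push_cast
  rw [show (n : ℤ) + 1 - k - 1 = n - k by ring] at a1
  rw [show (n : ℤ) + 1 + k - 1 = n + k by ring] at b1
  rw [show (n : ℤ) - (k - 1) = n + 1 - k by ring, show (n : ℤ) + (k - 1) = n + k - 1 by ring,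
    show (n : ℤ) - (k + 1) = n - k - 1 by ring, show (n : ℤ) + (k + 1) = n + 1 + k by ring,
    a2, b2, a1, b1]
  generalize invQPoch q ((n : ℤ) + 1 - k) = A
  generalize invQPoch q ((n : ℤ) + 1 + k) = B
  generalize qPoch q q (2 * n) = C
  have e1 : q ^ ((n : ℤ) - k) = q ^ ((n : ℤ) + 1 - k) / q := by
    rw [show (n : ℤ) + 1 - k = n - k + 1 by ring, zpow_add_one₀ hq0]; field_simp
  have e2 : q ^ ((n : ℤ) + k) = q ^ ((n : ℤ) + 1 + k) / q := by
    rw [show (n : ℤ) + 1 + k = n + k + 1 by ring, zpow_add_one₀ hq0]; field_simp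
  have e3 : q ^ (2 * n + 2) = q ^ ((n : ℤ) + 1 - k) * q ^ ((n : ℤ) + 1 + k) := by
    rw [← zpow_add₀ hq0, ← zpow_natCast]
    congr 1
    push_cast; ring
  have e4 : q ^ (2 * n + 1) = q ^ ((n : ℤ) + 1 - k) * q ^ ((n : ℤ) + 1 + k) / q := by
    rw [← e3, eq_div_iff hq0]; ring
  rw [e1, e2, e3, e4]
  generalize q ^ ((n : ℤ) + 1 - k) = a
  generalize q ^ ((n : ℤ) + 1 + k) = b
  field_simp
  ring

theorem hasSum_tripleCoeff {x q : ℂ} (hx : x ≠ 0) (hq0 : q ≠ 0) (hq : ‖q‖ < 1) (n : ℕ) :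
    HasSum (fun k : ℤ => (-1) ^ k * q ^ binom2 k * x ^ k * tripleCoeff q n k)
      (qPoch x q n * qPoch (q / x) q n) := by
  induction n with
  | zero =>
    have h : ∀ k : ℤ, k ≠ 0 → (-1) ^ k * q ^ binom2 k * x ^ k * tripleCoeff q 0 k = 0 := by
      intro k hk
      rcases hk.lt_or_gt with h | h
      · simp [tripleCoeff, invQPoch, h.not_ge]
      · simp [tripleCoeff, invQPoch, h.not_ge]
    have h1 := hasSum_single (0 : ℤ) h
    have h2 : (-1) ^ (0 : ℤ) * q ^ binom2 0 * x ^ (0 : ℤ) * tripleCoeff q 0 0 = 1 := by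
      simp [qPoch, tripleCoeff, invQPoch]
    rw [h2] at h1
    simpa [qPoch] using h1
  | succ n ih =>
    set f : ℤ → ℂ := fun k => (-1) ^ k * q ^ binom2 k * x ^ k * tripleCoeff q n k with hf
    have h1 := ih.mul_left (1 + q ^ (2 * n + 1))
    have h2 := ((Equiv.subRight (1 : ℤ)).hasSum_iff.2 ih).mul_left (-(x * q ^ n))
    have h3 := ((Equiv.addRight (1 : ℤ)).hasSum_iff.2 ih).mul_left (-(q ^ (n + 1) / x))
    convert! (h1.add h2).add h3 using 1
    · funext k
      have m1 : (-1 : ℂ) ≠ 0 := by norm_num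
      have hb : binom2 k = binom2 (k - 1) + (k - 1) := by
        conv_lhs => rw [← sub_add_cancel k 1, binom2_add_one]
      simp only [Function.comp, Equiv.subRight_apply, Equiv.coe_addRight, hf]
      rw [tripleCoeff_succ hq0 hq, binom2_add_one, zpow_sub_one₀ m1, zpow_sub_one₀ hx,
        zpow_add_one₀ m1, zpow_add_one₀ hx]
      have e0 : q ^ binom2 (k - 1) = q ^ binom2 k * q / q ^ k := by
        rw [hb, zpow_add₀ hq0, zpow_sub_one₀ hq0]
        have := zpow_ne_zero k hq0
        field_simp
      rw [e0, zpow_add₀ hq0 (binom2 k), zpow_sub₀ hq0, zpow_add₀ hq0 ((n : ℤ) + 1),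
        zpow_add_one₀ hq0, zpow_natCast]
      have := zpow_ne_zero k hq0
      field_simp
      ring
    · have e : ∀ y : ℂ, qPoch y q (n + 1) = qPoch y q n * (1 - y * q ^ n) := fun y =>
        Finset.prod_range_succ _ _
      rw [e, e]
      field_simp
      ring

/-- Uniformity in both `n` and `k` provides the dominating sequence when `n → ∞` in the finite
triple product. -/
theorem exists_norm_tripleCoeff_le {q : ℂ} (hq : ‖q‖ < 1) :
    ∃ C : ℝ, 0 < C ∧ ∀ n k, ‖tripleCoeff q n k‖ ≤ C := by
  have h := tendsto_qPoch q hq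
  have h' := h.inv₀ (qPochInf_ne_zero_of_norm_lt hq hq)
  obtain ⟨A, hA0, hA⟩ := (Metric.isBounded_range_of_tendsto _ h).exists_pos_norm_le
  obtain ⟨B, hB0, hB⟩ := (Metric.isBounded_range_of_tendsto _ h').exists_pos_norm_le
  have hB' : ∀ m, ‖invQPoch q m‖ ≤ B := by
    intro m
    rw [invQPoch]
    split_ifs
    · exact hB _ ⟨_, rfl⟩
    · simpa using hB0.le
  refine ⟨A * (B * B), by positivity, fun n k => ?_⟩
  rw [tripleCoeff, norm_mul, norm_mul]
  gcongr
  · exact hA _ ⟨_, rfl⟩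
  · exact hB' _
  · exact hB' _

theorem tendsto_invQPoch {q : ℂ} (hq : ‖q‖ < 1) {f : ℕ → ℤ} (hf : Tendsto f atTop atTop) :
    Tendsto (fun n => invQPoch q (f n)) atTop (𝓝 (qPochInf q q)⁻¹) := by
  have h' := (tendsto_qPoch q hq).inv₀ (qPochInf_ne_zero_of_norm_lt hq hq)
  have h2 : Tendsto (fun n => (f n).toNat) atTop atTop := by
    rw [tendsto_atTop] at hf ⊢
    intro b
    filter_upwards [hf b] with n hn
    omega
  refine (h'.comp h2).congr' ?_
  filter_upwards [hf.eventually_ge_atTop 0] with n hn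
  simp [invQPoch, hn]

theorem tendsto_tripleCoeff {q : ℂ} (hq : ‖q‖ < 1) (k : ℤ) :
    Tendsto (fun n => tripleCoeff q n k) atTop (𝓝 (qPochInf q q)⁻¹) := by
  have h1 : Tendsto (fun n : ℕ => (n : ℤ) - k) atTop atTop :=
    tendsto_atTop_add_const_right _ (-k) tendsto_natCast_atTop_atTop
  have h2 : Tendsto (fun n : ℕ => (n : ℤ) + k) atTop atTop :=
    tendsto_atTop_add_const_right _ k tendsto_natCast_atTop_atTop
  have h3 : Tendsto (fun n : ℕ => qPoch q q (2 * n)) atTop (𝓝 (qPochInf q q)) :=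
    (tendsto_qPoch q hq).comp (tendsto_id.const_mul_atTop' two_pos)
  convert! h3.mul ((tendsto_invQPoch hq h1).mul (tendsto_invQPoch hq h2)) using 2
  have := qPochInf_ne_zero_of_norm_lt hq hq
  field_simp

theorem summable_norm_thetaTerm {x q : ℂ} (hx : x ≠ 0) (hq0 : q ≠ 0) (hq : ‖q‖ < 1) :
    Summable fun r : ℤ => ‖(-1) ^ r * q ^ binom2 r * x ^ r‖ := by
  simpa [norm_mul, norm_zpow] using summable_gauss (norm_pos_iff.2 hq0) hq (norm_pos_iff.2 hx)

/-- The Jacobi triple product identity. -/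
theorem hasSum_theta {x q : ℂ} (hx : x ≠ 0) (hq0 : q ≠ 0) (hq : ‖q‖ < 1) :
    HasSum (fun r : ℤ => (-1) ^ r * q ^ binom2 r * x ^ r) (theta x q) := by
  have hs := summable_norm_thetaTerm hx hq0 hq
  have hJ := qPochInf_ne_zero_of_norm_lt hq hq
  obtain ⟨C, hC0, hC⟩ := exists_norm_tripleCoeff_le hq
  have key : Tendsto (fun n : ℕ => ∑' k : ℤ, (-1) ^ k * q ^ binom2 k * x ^ k * tripleCoeff q n k)
      atTop (𝓝 (∑' k : ℤ, (-1) ^ k * q ^ binom2 k * x ^ k * (qPochInf q q)⁻¹)) := by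
    refine tendsto_tsum_of_dominated_convergence (hs.mul_right C)
      (fun k => (tendsto_tripleCoeff hq k).const_mul _) (Eventually.of_forall fun n k => ?_)
    rw [norm_mul]
    gcongr
    exact hC n k
  simp_rw [fun n => (hasSum_tripleCoeff hx hq0 hq n).tsum_eq] at key
  have h := tendsto_nhds_unique key ((tendsto_qPoch x hq).mul (tendsto_qPoch (q / x) hq))
  rw [tsum_mul_right] at h
  have h2 := hs.of_norm.hasSum
  rwa [show ∑' r : ℤ, (-1) ^ r * q ^ binom2 r * x ^ r = theta x q by
    rw [theta, ← h, inv_mul_cancel_right₀ hJ]] at h2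

/-! ### Uniqueness for holomorphic functions that are quasi-periodic on the punctured plane -/

/-- Liouville's theorem on the punctured plane modulo `q`. -/
theorem eq_of_norm_q_mul_eq {h : ℂ → ℂ} {q : ℂ} (hq0 : q ≠ 0) (hq : ‖q‖ < 1)
    (hd : DifferentiableOn ℂ h {0}ᶜ) (hh : ∀ x, x ≠ 0 → ‖h (q * x)‖ = ‖h x‖)
    {x y : ℂ} (hx : x ≠ 0) (hy : y ≠ 0) : h x = h y := by
  have hq0' : 0 < ‖q‖ := norm_pos_iff.2 hq0
  have hz : ∀ (k : ℤ) (x : ℂ), x ≠ 0 → ‖h (q ^ k * x)‖ = ‖h x‖ := by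
    intro k x hx
    have step : ∀ k : ℤ, ‖h (q ^ (k + 1) * x)‖ = ‖h (q ^ k * x)‖ := by
      intro k
      rw [← hh _ (mul_ne_zero (zpow_ne_zero k hq0) hx), zpow_add_one₀ hq0]
      congr 2; ring
    induction k with
    | zero => simp
    | succ n ih => rw [step, ih]
    | pred n ih => rw [← ih, ← step]; simp
  set K : Set ℂ := Metric.closedBall 0 1 \ Metric.ball 0 ‖q‖ with hK
  have hKc : IsCompact K := (isCompact_closedBall _ _).diff Metric.isOpen_ball
  have hK0 : K ⊆ {0}ᶜ := by
    rintro z ⟨-, hz⟩ rfl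
    simp [hq0] at hz
  obtain ⟨C, hC⟩ := hKc.exists_bound_of_continuousOn (hd.continuousOn.mono hK0)
  have hC' : ∀ z, z ≠ 0 → ‖h z‖ ≤ C := by
    intro z hz0
    -- Every orbit of multiplication by `q` meets the compact annulus `|q| ≤ |z| ≤ 1`, so a bound
    -- there is global; `h ∘ exp` is then entire and bounded.
    obtain ⟨n, hn1, hn2⟩ := exists_mem_Ioc_zpow (norm_pos_iff.2 hz0) ((one_lt_inv₀ hq0').2 hq)
    rw [← hz (n + 1) z hz0]
    apply hC
    have e : ‖q ^ (n + 1) * z‖ = ‖z‖ / (‖q‖⁻¹) ^ (n + 1) := by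
      rw [norm_mul, norm_zpow, inv_zpow, div_inv_eq_mul, mul_comm]
    have hp : 0 < (‖q‖⁻¹) ^ (n + 1) := by positivity
    refine ⟨?_, ?_⟩
    · rw [mem_closedBall_zero_iff, e, div_le_one hp]; exact hn2
    · rw [mem_ball_zero_iff, e, not_lt, le_div_iff₀ hp, zpow_add_one₀ (by positivity),
        mul_comm, mul_assoc, inv_mul_cancel₀ hq0'.ne', mul_one]
      exact hn1.le
  have hent : Differentiable ℂ fun u => h (Complex.exp u) := fun u =>
    (hd.differentiableAt (isOpen_ne_zero.mem_nhds (Complex.exp_ne_zero u))).comp u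
      Complex.differentiable_exp.differentiableAt
  have hb : Bornology.IsBounded (Set.range fun u => h (Complex.exp u)) := by
    rw [isBounded_iff_forall_norm_le]
    refine ⟨C, ?_⟩
    rintro _ ⟨u, rfl⟩
    exact hC' _ (Complex.exp_ne_zero u)
  have := hent.apply_eq_apply_of_bounded hb (Complex.log x) (Complex.log y)
  simpa [Complex.exp_log hx, Complex.exp_log hy] using this

theorem exists_countable_theta_ne_zero {q : ℂ} (hq : ‖q‖ < 1) (x : ℂ) :
    ∃ S : Set ℂ, S.Countable ∧ ∀ y, y ∉ S → theta (x * y) q ≠ 0 ∨ x = 0 := by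
  refine ⟨Set.range fun k : ℤ => x⁻¹ * q ^ k, Set.countable_range _, fun y hy => ?_⟩
  by_cases hx : x = 0
  · exact Or.inr hx
  refine Or.inl (theta_ne_zero hq fun k hk => hy ⟨k, ?_⟩)
  simp only [← hk]
  field_simp

/-- There is no nonzero holomorphic function of negative degree. -/
theorem eq_zero_of_degree_neg {D : ℂ → ℂ} {q c : ℂ} (hq0 : q ≠ 0) (hq : ‖q‖ < 1)
    (hD : DifferentiableOn ℂ D {0}ᶜ) (hc : c ≠ 0) (n : ℕ)
    (h : ∀ x, x ≠ 0 → D (q * x) = c * x ^ (n + 1) * D x) {x : ℂ} (hx : x ≠ 0) : D x = 0 := by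
  -- Multiplying `D` by `n + 1` theta factors cancels `x^(n+1)`. The shift `t` in the last one makes
  -- the remaining constant equal to `1`, and the zero of that factor at `x = t⁻¹` forces the
  -- resulting constant function to be `0`.
  set t : ℂ := c * (-1) ^ (n + 1) with ht
  have ht0 : t ≠ 0 := mul_ne_zero hc (pow_ne_zero _ (by norm_num))
  have hθ := differentiableOn_theta hq
  have hmaps : Set.MapsTo (fun x => t * x) {0}ᶜ {0}ᶜ := fun x hx => mul_ne_zero ht0 hx
  set G : ℂ → ℂ := fun x => D x * theta x q ^ n * theta (t * x) q with hG
  have hGd : DifferentiableOn ℂ G {0}ᶜ :=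
    (hD.mul (hθ.pow n)).mul (hθ.comp (by fun_prop) hmaps)
  have hGq : ∀ x, x ≠ 0 → ‖G (q * x)‖ = ‖G x‖ := by
    intro x hx
    congr 1
    simp only [hG]
    rw [h x hx, theta_q_mul hx hq0 hq, mul_left_comm t q x, theta_q_mul (mul_ne_zero ht0 hx) hq0 hq,
      mul_pow, show -x⁻¹ = (-1) * x⁻¹ by ring, mul_pow, inv_pow]
    generalize theta (t * x) q = T
    have hxn := pow_ne_zero n hx
    have hc' : c * (-1) ^ n = -t := by rw [ht, pow_succ]; ring
    have e : c * x ^ (n + 1) * D x * ((-1) ^ n * (x ^ n)⁻¹ * theta x q ^ n) * (-(t * x)⁻¹ * T) =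
        (c * (-1) ^ n) * (D x * theta x q ^ n) * (-t⁻¹ * T) := by
      field_simp
      ring
    rw [e, hc']
    field_simp
  have hG0 : ∀ x, x ≠ 0 → G x = 0 := by
    intro x hx
    rw [eq_of_norm_q_mul_eq hq0 hq hGd hGq hx (inv_ne_zero ht0)]
    simp only [hG]
    rw [mul_inv_cancel₀ ht0, theta_one hq, mul_zero]
  obtain ⟨S1, hS1, h1⟩ := exists_countable_theta_ne_zero hq 1
  obtain ⟨S2, hS2, h2⟩ := exists_countable_theta_ne_zero hq t
  refine eqOn_of_countable (hS1.union hS2) hD.continuousOn (g := fun _ => 0)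
    continuousOn_const (fun y hy hyS => ?_) hx
  rw [Set.mem_union, not_or] at hyS
  have e1 := (h1 y hyS.1).resolve_right one_ne_zero
  have e2 := (h2 y hyS.2).resolve_right ht0
  have e := hG0 y hy
  simp only [hG] at e
  rw [one_mul] at e1
  simpa [e1, e2] using e

/-- `q`-inequivalence of nonzero complex numbers. -/
def QInequiv (q a b : ℂ) : Prop := ∀ k : ℤ, b ≠ a * q ^ k

/-- A holomorphic function on the punctured plane vanishing on `a q^ℤ` is divisible by
`Θ(x/a;q)`. -/
theorem exists_eq_mul_theta {E : ℂ → ℂ} {q a : ℂ} (hq0 : q ≠ 0) (hq : ‖q‖ < 1) (ha : a ≠ 0)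
    (hE : DifferentiableOn ℂ E {0}ᶜ) (hz : ∀ k : ℤ, E (a * q ^ k) = 0) :
    ∃ D : ℂ → ℂ, DifferentiableOn ℂ D {0}ᶜ ∧ ∀ x, x ≠ 0 → E x = D x * theta (a⁻¹ * x) q := by
  have hθ := differentiableOn_theta hq
  have ha' := inv_ne_zero ha
  have hmaps : Set.MapsTo (fun x => a⁻¹ * x) {0}ᶜ {0}ᶜ := fun x hx => mul_ne_zero ha' hx
  have hθa : DifferentiableOn ℂ (fun x => theta (a⁻¹ * x) q) {0}ᶜ := hθ.comp (by fun_prop) hmaps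
  have hlocal : ∀ x, x ≠ 0 → ∃ V : Set ℂ, IsOpen V ∧ x ∈ V ∧ V ⊆ {0}ᶜ ∧ ∃ d : ℂ → ℂ,
      DifferentiableOn ℂ d V ∧ (∀ y ∈ V, E y = d y * theta (a⁻¹ * y) q) ∧
      ∀ y ∈ V, y ≠ x → theta (a⁻¹ * y) q ≠ 0 := by
    intro x hx
    by_cases hxθ : theta (a⁻¹ * x) q = 0
    · obtain ⟨k, hk⟩ : ∃ k : ℤ, a⁻¹ * x = q ^ k := by
        by_contra! hcon
        exact theta_ne_zero hq hcon hxθ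
      have hxk : x = a * q ^ k := by rw [← hk]; field_simp
      have hEx : E x = 0 := by rw [hxk]; exact hz k
      have hdE : DifferentiableOn ℂ (dslope E x) {0}ᶜ :=
        (Complex.differentiableOn_dslope (isOpen_ne_zero.mem_nhds hx)).2 hE
      have hdθ : DifferentiableOn ℂ (dslope (fun y => theta (a⁻¹ * y) q) x) {0}ᶜ :=
        (Complex.differentiableOn_dslope (isOpen_ne_zero.mem_nhds hx)).2 hθa
      set u := dslope (fun y => theta (a⁻¹ * y) q) x with hu
      have hfac : ∀ y, theta (a⁻¹ * y) q = (y - x) * u y := by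
        intro y
        have := sub_smul_dslope (fun y => theta (a⁻¹ * y) q) x y
        simp only [hxθ, sub_zero, smul_eq_mul] at this
        exact this.symm
      -- The zero of the theta function is simple; this is what makes the quotient by it holomorphic
      -- at `x`.
      have hux : u x ≠ 0 := by
        -- compare with the explicit factorisation through `thetaReg`
        set v : ℂ → ℂ := fun y => (-1) ^ (-k) * q ^ binom2 (-k) * (a⁻¹ * y) ^ (-k) *
          (-x⁻¹) * thetaReg (q ^ (-k) * (a⁻¹ * y)) q with hv
        have hqk : q ^ (-k) ≠ 0 := zpow_ne_zero _ hq0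
        have hvc : ContinuousAt v x := by
          have hr : DifferentiableAt ℂ (fun y => thetaReg (q ^ (-k) * (a⁻¹ * y)) q) x :=
            ((differentiableOn_thetaReg hq).differentiableAt (isOpen_ne_zero.mem_nhds
              (mul_ne_zero hqk (mul_ne_zero ha' hx)))).comp x
              (f := fun y => q ^ (-k) * (a⁻¹ * y)) (by fun_prop)
          have hp : ContinuousAt (fun y : ℂ => (a⁻¹ * y) ^ (-k)) x :=
            ContinuousAt.zpow₀ (by fun_prop) _ (Or.inl (mul_ne_zero ha' hx))
          exact ((continuousAt_const.mul hp).mul continuousAt_const).mul hr.continuousAt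
        have huv : ∀ᶠ y in 𝓝[≠] x, u y = v y := by
          have : ∀ᶠ y in 𝓝[≠] x, y ≠ 0 :=
            mem_nhdsWithin_of_mem_nhds (isOpen_ne_zero.mem_nhds hx)
          filter_upwards [this, self_mem_nhdsWithin] with y hy hyx
          have hyx : y - x ≠ 0 := sub_ne_zero.2 hyx
          apply mul_left_cancel₀ hyx
          rw [← hfac, ← theta_zpow_mul (mul_ne_zero ha' hy) hq0 hq (-k),
            theta_eq_mul_thetaReg _ hq]
          have e : q ^ (-k) * (a⁻¹ * y) = y / x := by
            rw [hxk, zpow_neg]; field_simp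
          simp only [hv]
          rw [e]
          field_simp
          ring
        have hlim : u x = v x := by
          have h1 : Tendsto u (𝓝[≠] x) (𝓝 (u x)) :=
            ((hdθ.differentiableAt (isOpen_ne_zero.mem_nhds hx)).continuousAt.tendsto).mono_left
              nhdsWithin_le_nhds
          have h2 : Tendsto v (𝓝[≠] x) (𝓝 (v x)) := hvc.tendsto.mono_left nhdsWithin_le_nhds
          exact tendsto_nhds_unique (h1.congr' huv) h2
        rw [hlim]
        have e : q ^ (-k) * (a⁻¹ * x) = 1 := by
          rw [hk, ← zpow_add₀ hq0, neg_add_cancel, zpow_zero]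
        simp only [hv]
        rw [e, thetaReg_one]
        have hJ := qPochInf_ne_zero_of_norm_lt hq hq
        have h1 : (-1 : ℂ) ^ (-k) ≠ 0 := zpow_ne_zero _ (by norm_num)
        have h2 : q ^ binom2 (-k) ≠ 0 := zpow_ne_zero _ hq0
        have h3 : (a⁻¹ * x) ^ (-k) ≠ 0 := zpow_ne_zero _ (mul_ne_zero ha' hx)
        exact mul_ne_zero (mul_ne_zero (mul_ne_zero (mul_ne_zero h1 h2) h3)
          (neg_ne_zero.2 (inv_ne_zero hx))) (pow_ne_zero _ hJ)
      obtain ⟨V, hVs, hVo, hxV⟩ := mem_nhds_iff.1 (inter_mem (isOpen_ne_zero.mem_nhds hx)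
        ((hdθ.differentiableAt (isOpen_ne_zero.mem_nhds hx)).continuousAt.eventually_ne hux))
      have hV0 : V ⊆ {0}ᶜ := fun y hy => (hVs hy).1
      have hVu : ∀ y ∈ V, u y ≠ 0 := fun y hy => (hVs hy).2
      refine ⟨V, hVo, hxV, hV0, fun y => dslope E x y / u y,
        (hdE.mono hV0).div (hdθ.mono hV0) hVu, fun y hy => ?_, fun y hy hyx => ?_⟩
      · have := sub_smul_dslope E x y
        simp only [hEx, sub_zero, smul_eq_mul] at this
        rw [hfac, ← this]
        have := hVu y hy
        field_simp
      · rw [hfac]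
        exact mul_ne_zero (sub_ne_zero.2 hyx) (hVu y hy)
    · obtain ⟨V, hVs, hVo, hxV⟩ := mem_nhds_iff.1 (inter_mem (isOpen_ne_zero.mem_nhds hx)
        ((hθa.differentiableAt (isOpen_ne_zero.mem_nhds hx)).continuousAt.eventually_ne hxθ))
      have hV0 : V ⊆ {0}ᶜ := fun y hy => (hVs hy).1
      have hVu : ∀ y ∈ V, theta (a⁻¹ * y) q ≠ 0 := fun y hy => (hVs hy).2
      exact ⟨V, hVo, hxV, hV0, fun y => E y / theta (a⁻¹ * y) q,
        (hE.mono hV0).div (hθa.mono hV0) hVu,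
        fun y hy => (div_mul_cancel₀ _ (hVu y hy)).symm, fun y hy _ => hVu y hy⟩
  choose! V hVo hxV hV0 d hd hEd hθV using hlocal
  -- The local quotients glue: on `V x` the theta factor vanishes at most at the centre, so away
  -- from the centre both quotients are determined by `E`.
  refine ⟨fun x => d x x, fun x hx => ?_, fun x hx => hEd x hx x (hxV x hx)⟩
  have heq : ∀ y ∈ V x, d y y = d x y := by
    intro y hy
    by_cases hyx : y = x
    · rw [hyx]
    have hy0 : y ≠ 0 := hV0 x hx hy
    refine mul_right_cancel₀ (hθV x hx y hy hyx) ?_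
    rw [← hEd x hx y hy, ← hEd y hy0 y (hxV y hy0)]
  have h1 : DifferentiableAt ℂ (d x) x :=
    (hd x hx).differentiableAt ((hVo x hx).mem_nhds (hxV x hx))
  refine (h1.congr_of_eventuallyEq ?_).differentiableWithinAt
  filter_upwards [(hVo x hx).mem_nhds (hxV x hx)] with y hy using heq y hy

/-- A holomorphic function of degree less than the number of its inequivalent zeros vanishes. -/
theorem eq_zero_of_zeros {q : ℂ} (hq0 : q ≠ 0) (hq : ‖q‖ < 1) (l : List ℂ) :
    ∀ (E : ℂ → ℂ) (c : ℂ) (n : ℤ), DifferentiableOn ℂ E {0}ᶜ → c ≠ 0 →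
    (∀ x, x ≠ 0 → E (q * x) = c * x ^ (-n) * E x) → (∀ a ∈ l, a ≠ 0) → l.Pairwise (QInequiv q) →
    (∀ a ∈ l, E a = 0) → n < l.length → ∀ x, x ≠ 0 → E x = 0 := by
  induction l with
  | nil =>
    intro E c n hE hc hEq _ _ _ hn x hx
    obtain ⟨m, hm⟩ : ∃ m : ℕ, -n = ((m + 1 : ℕ) : ℤ) :=
      ⟨(-n - 1).toNat, by simp at hn; omega⟩
    refine eq_zero_of_degree_neg hq0 hq hE hc m (fun x hx => ?_) hx
    rw [hEq x hx, hm, zpow_natCast]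
  | cons a l ih =>
    intro E c n hE hc hEq hl0 hp hlz hn x hx
    have ha : a ≠ 0 := hl0 a (by simp)
    have hz : ∀ k : ℤ, E (a * q ^ k) = 0 := by
      have step : ∀ k : ℤ, E (a * q ^ (k + 1)) = 0 ↔ E (a * q ^ k) = 0 := by
        intro k
        have hne : a * q ^ k ≠ 0 := mul_ne_zero ha (zpow_ne_zero k hq0)
        have e : a * q ^ (k + 1) = q * (a * q ^ k) := by rw [zpow_add_one₀ hq0]; ring
        rw [e, hEq _ hne]
        simp [hc, zpow_ne_zero, hne]
      intro k
      induction k with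
      | zero => simpa using hlz a (by simp)
      | succ n ih => exact (step _).2 ih
      | pred n ih => exact (step _).1 (by simpa using ih)
    obtain ⟨D, hD, hED⟩ := exists_eq_mul_theta hq0 hq ha hE hz
    have ha' := inv_ne_zero ha
    have hDq : ∀ x, x ≠ 0 → D (q * x) = (-a⁻¹ * c) * x ^ (-(n - 1)) * D x := by
      intro x hx
      have hmq : Set.MapsTo (fun x => q * x) ({0}ᶜ : Set ℂ) {0}ᶜ := fun x hx => mul_ne_zero hq0 hx
      -- The theta factor can be cancelled only off its countable zero set; continuity extends the
      -- relation to the remaining points.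
      obtain ⟨S, hS, hSθ⟩ := exists_countable_theta_ne_zero hq a⁻¹
      refine eqOn_of_countable (f := fun x => D (q * x))
        (g := fun x => (-a⁻¹ * c) * x ^ (-(n - 1)) * D x) hS
        (hD.continuousOn.comp (by fun_prop) hmq) ?_ ?_ hx
      · refine ContinuousOn.mul (continuousOn_const.mul ?_) hD.continuousOn
        exact continuousOn_id.zpow₀ _ fun x hx => Or.inl hx
      · intro y hy hyS
        have hθ := (hSθ y hyS).resolve_right ha'
        have h1 := hEq y hy
        rw [hED y hy, hED _ (mul_ne_zero hq0 hy), mul_left_comm a⁻¹ q y,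
          theta_q_mul (mul_ne_zero ha' hy) hq0 hq] at h1
        have h2 : D (q * y) * (-(a⁻¹ * y)⁻¹) = c * y ^ (-n) * D y :=
          mul_right_cancel₀ hθ (by rw [mul_assoc, h1]; ring)
        have h3 : y ^ (-(n - 1)) = y ^ (-n) * y := by
          rw [show -(n - 1) = -n + 1 by ring, zpow_add_one₀ hy]
        simp only [h3]
        field_simp at h2 ⊢
        linear_combination (-1 : ℂ) * h2
    have := ih D (-a⁻¹ * c) (n - 1) hD (mul_ne_zero (neg_ne_zero.2 ha') hc) hDq
      (fun b hb => hl0 b (by simp [hb])) (List.pairwise_cons.1 hp).2 (fun b hb => ?_)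
      (by simp at hn; omega) x hx
    · rw [hED x hx, this, zero_mul]
    · have hb0 : b ≠ 0 := hl0 b (by simp [hb])
      have h1 := hlz b (by simp [hb])
      rw [hED b hb0] at h1
      -- Inequivalence of `a` and `b` gives `Θ(b/a;q) ≠ 0`, so `b` remains a zero of the quotient.
      refine (mul_eq_zero.1 h1).resolve_right (theta_ne_zero hq fun k hk => ?_)
      refine (List.pairwise_cons.1 hp).1 b hb k ?_
      rw [← hk]; field_simp

/-! ### Appell sums -/

/-- As `r → ±∞`, `q^r w` tends to `0` or `∞` uniformly on the annulus. Hence only finitely many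
denominators can be small there. -/
theorem eventually_half_le_norm_one_sub {q : ℂ} (hq0 : q ≠ 0) (hq : ‖q‖ < 1) {R : ℝ} (hR : 0 < R) :
    ∀ᶠ r : ℤ in cofinite, ∀ w : ℂ, R⁻¹ ≤ ‖w‖ → ‖w‖ ≤ R → 1 / 2 ≤ ‖1 - q ^ r * w‖ := by
  have hq0' : 0 < ‖q‖ := norm_pos_iff.2 hq0
  obtain ⟨N, hN⟩ := exists_pow_lt_of_lt_one (show 0 < (2 * R)⁻¹ by positivity) hq
  have hN1 : ‖q‖ ^ (N : ℤ) * R ≤ 1 / 2 := by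
    rw [zpow_natCast]
    calc ‖q‖ ^ N * R ≤ (2 * R)⁻¹ * R := by gcongr
      _ = 1 / 2 := by field_simp
  have hN2 : 2 ≤ ‖q‖ ^ (-(N : ℤ)) * R⁻¹ := by
    rw [zpow_neg, ← mul_inv, le_inv_comm₀ two_pos (by positivity)]
    simpa using hN1
  refine (Set.finite_Ioo (-(N : ℤ)) N).subset fun r hr => ?_
  by_contra hcon
  refine hr fun w hw1 hw2 => ?_
  rw [Set.mem_Ioo, not_and_or, not_lt, not_lt] at hcon
  rcases hcon with h | h
  · have h1 : 2 ≤ ‖q ^ r * w‖ := by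
      rw [norm_mul, norm_zpow]
      refine hN2.trans ?_
      gcongr ?_ * ?_
      exact zpow_le_zpow_right_of_le_one₀ hq0' hq.le h
    have := norm_sub_norm_le (q ^ r * w) 1
    rw [norm_one, norm_sub_rev] at this
    linarith
  · have h1 : ‖q ^ r * w‖ ≤ 1 / 2 := by
      rw [norm_mul, norm_zpow]
      refine le_trans ?_ hN1
      gcongr ?_ * ?_
      exact zpow_le_zpow_right_of_le_one₀ hq0' hq.le h
    have := norm_sub_norm_le 1 (q ^ r * w)
    rw [norm_one] at this
    linarith

theorem summable_div_one_sub {q : ℂ} (hq0 : q ≠ 0) (hq : ‖q‖ < 1) {c : ℤ → ℂ}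
    (hc : Summable fun r => ‖c r‖) {w : ℂ} (hw : w ≠ 0) :
    Summable fun r : ℤ => c r / (1 - q ^ r * w) := by
  obtain ⟨R, hR, U, -, hwU, -, hU⟩ := exists_annulus_nhds hw
  refine Summable.of_norm_bounded_eventually (hc.mul_right 2) ?_
  filter_upwards [eventually_half_le_norm_one_sub hq0 hq hR] with r hr
  have h := hr w (hU w hwU).1 (hU w hwU).2
  rw [norm_div, div_le_iff₀ (by linarith)]
  nlinarith [norm_nonneg (c r)]

/-- The function `Θ(w;q) / (1 - q^r w)`, extended holomorphically to its removable singularity. -/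
def thetaDiv (q : ℂ) (r : ℤ) (w : ℂ) : ℂ :=
  (-1) ^ r * q ^ binom2 r * w ^ r * thetaReg (q ^ r * w) q

theorem one_sub_mul_thetaDiv {q w : ℂ} (hq0 : q ≠ 0) (hq : ‖q‖ < 1) (hw : w ≠ 0) (r : ℤ) :
    (1 - q ^ r * w) * thetaDiv q r w = theta w q := by
  rw [← theta_zpow_mul hw hq0 hq r, theta_eq_mul_thetaReg _ hq, thetaDiv]
  ring

theorem differentiableOn_thetaDiv {q : ℂ} (hq0 : q ≠ 0) (hq : ‖q‖ < 1) (r : ℤ) :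
    DifferentiableOn ℂ (thetaDiv q r) {0}ᶜ := by
  have hqr := zpow_ne_zero r hq0
  have hmaps : Set.MapsTo (fun x => q ^ r * x) {0}ᶜ {0}ᶜ := fun x hx => mul_ne_zero hqr hx
  refine DifferentiableOn.mul (DifferentiableOn.const_mul ?_ _)
    ((differentiableOn_thetaReg hq).comp (by fun_prop) hmaps)
  exact fun x hx => (differentiableAt_zpow.2 (Or.inl hx)).differentiableWithinAt

/-- The holomorphic function `Θ(w;q) ∑ c_r / (1 - q^r w)`. -/
def thetaMulSum (c : ℤ → ℂ) (q w : ℂ) : ℂ := ∑' r : ℤ, c r * thetaDiv q r w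

theorem differentiableOn_thetaMulSum {q : ℂ} (hq0 : q ≠ 0) (hq : ‖q‖ < 1) {c : ℤ → ℂ}
    (hc : Summable fun r => ‖c r‖) : DifferentiableOn ℂ (thetaMulSum c q) {0}ᶜ := by
  intro w hw
  obtain ⟨R, hR, U, hUo, hwU, hU0, hU⟩ := exists_annulus_nhds hw
  obtain ⟨C, hC⟩ : ∃ C : ℝ, ∀ y : ℂ, R⁻¹ ≤ ‖y‖ → ‖y‖ ≤ R → ‖theta y q‖ ≤ C := by
    have hK : IsCompact (Metric.closedBall (0 : ℂ) R \ Metric.ball 0 R⁻¹) :=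
      (isCompact_closedBall _ _).diff Metric.isOpen_ball
    obtain ⟨C, hC⟩ := hK.exists_bound_of_continuousOn
      ((differentiableOn_theta hq).continuousOn.mono (by
        rintro z ⟨-, hz⟩ rfl
        simp [hR] at hz))
    exact ⟨C, fun y h1 h2 => hC y ⟨by simpa using h2, by simpa using h1⟩⟩
  have hd : DifferentiableOn ℂ (thetaMulSum c q) U := by
    refine differentiableOn_tsum_of_eventually hUo (hc.mul_right (2 * C))
      (fun r => ((differentiableOn_thetaDiv hq0 hq r).mono hU0).const_mul _) ?_
    filter_upwards [eventually_half_le_norm_one_sub hq0 hq hR] with r hr y hy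
    rw [norm_mul]
    gcongr
    have h1 := hr y (hU y hy).1 (hU y hy).2
    have h2 := hC y (hU y hy).1 (hU y hy).2
    rw [← one_sub_mul_thetaDiv hq0 hq (hU0 hy) r, norm_mul] at h2
    nlinarith [norm_nonneg (thetaDiv q r y)]
  exact (hd.differentiableAt (hUo.mem_nhds hwU)).differentiableWithinAt

theorem one_sub_zpow_mul_ne_zero {q w : ℂ} (h : ∀ k : ℤ, w ≠ q ^ k) (r : ℤ) :
    1 - q ^ r * w ≠ 0 := by
  intro h'
  refine h (-r) ?_
  rw [zpow_neg]
  exact eq_inv_of_mul_eq_one_right (sub_eq_zero.1 h').symm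

theorem thetaMulSum_eq {q w : ℂ} (hq0 : q ≠ 0) (hq : ‖q‖ < 1) (c : ℤ → ℂ) (hw : w ≠ 0)
    (h : ∀ k : ℤ, w ≠ q ^ k) :
    thetaMulSum c q w = theta w q * ∑' r : ℤ, c r / (1 - q ^ r * w) := by
  rw [thetaMulSum, ← tsum_mul_left]
  refine tsum_congr fun r => ?_
  have h1 := one_sub_zpow_mul_ne_zero h r
  rw [← one_sub_mul_thetaDiv hq0 hq hw r]
  field_simp

theorem zpow_ne_one {q : ℂ} (hq : ‖q‖ < 1) {r : ℤ} (hr : r ≠ 0) : q ^ r ≠ 1 := by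
  intro h
  have h1 : ‖q‖ ^ r = 1 := by rw [← norm_zpow, h, norm_one]
  exact hr ((zpow_eq_one_iff_right₀ (norm_nonneg q) hq.ne).1 h1)

/-- A residue computation: `Θ(w;q)` vanishes at `w = 1`, and only the denominator with `r = 0`
vanishes there too. -/
theorem thetaMulSum_one {q : ℂ} (hq0 : q ≠ 0) (hq : ‖q‖ < 1) (c : ℤ → ℂ) :
    thetaMulSum c q 1 = c 0 * qPochInf q q ^ 3 := by
  rw [thetaMulSum, tsum_eq_single 0]
  · simp [thetaDiv, thetaReg_one]
  · intro r hr
    have := one_sub_mul_thetaDiv hq0 hq one_ne_zero r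
    rw [theta_one hq, mul_one] at this
    rw [(mul_eq_zero.1 this).resolve_left (sub_ne_zero.2 (zpow_ne_one hq hr).symm), mul_zero]

/-- The sum `∑ (-1)^r q^{r(r-1)/2} z^r / (1 - q^r w)`. -/
def appellSum (w z q : ℂ) : ℂ :=
  ∑' r : ℤ, (-1) ^ r * q ^ binom2 r * z ^ r / (1 - q ^ r * w)

theorem summable_appellSum {w z q : ℂ} (hq0 : q ≠ 0) (hq : ‖q‖ < 1) (hz : z ≠ 0) (hw : w ≠ 0) :
    Summable fun r : ℤ => (-1) ^ r * q ^ binom2 r * z ^ r / (1 - q ^ r * w) :=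
  summable_div_one_sub hq0 hq (summable_norm_thetaTerm hz hq0 hq) hw

/-- The parameter `w = xz/q` locates the poles. For the two Appell functions in base `q³` it is the
constant `-q⁻¹` or `-q⁻²`, so only `z` varies with `x`; for the third, `z = -1` is fixed and `w =
-x⁻²` varies. -/
theorem appellTerm_eq {x z q w : ℂ} (hq0 : q ≠ 0) (h : x * z = q * w) (r : ℤ) :
    appellTerm x z q r = (-1) ^ r * q ^ binom2 r * z ^ r / (1 - q ^ r * w) := by
  rw [appellTerm, mul_assoc _ x z, h, zpow_sub_one₀ hq0]
  congr 2
  field_simp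

theorem summable_appellTerm {x z q w : ℂ} (hq0 : q ≠ 0) (hq : ‖q‖ < 1) (h : x * z = q * w)
    (hz : z ≠ 0) (hw : w ≠ 0) : Summable (appellTerm x z q) := by
  simp_rw [funext (appellTerm_eq hq0 h)]
  exact summable_appellSum hq0 hq hz hw

theorem appell_eq {x z q w : ℂ} (hq0 : q ≠ 0) (h : x * z = q * w) :
    appell x z q = appellSum w z q / theta z q := by
  rw [appell, tsum_congr (appellTerm_eq hq0 h), appellSum, one_div, inv_mul_eq_div]

theorem differentiableOn_appellSum {w q : ℂ} (hq0 : q ≠ 0) (hq : ‖q‖ < 1) (hw : w ≠ 0) :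
    DifferentiableOn ℂ (fun z => appellSum w z q) {0}ᶜ := by
  intro z hz
  have hq0' : 0 < ‖q‖ := norm_pos_iff.2 hq0
  obtain ⟨R, hR, U, hUo, hzU, hU0, hU⟩ := exists_annulus_nhds hz
  obtain ⟨R', hR', U', -, hwU, -, hU'⟩ := exists_annulus_nhds hw
  have hd : DifferentiableOn ℂ (fun z => appellSum w z q) U := by
    refine differentiableOn_tsum_of_eventually hUo
      ((summable_gauss_abs hq0' hq hR).mul_right 2) (fun r y hy => ?_) ?_
    · exact (((differentiableAt_zpow.2 (Or.inl (hU0 hy))).const_mul _).div_const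
        _).differentiableWithinAt
    · filter_upwards [eventually_half_le_norm_one_sub hq0 hq hR'] with r hr y hy
      have h := hr w (hU' w hwU).1 (hU' w hwU).2
      have h2 := zpow_le_add_inv (hU y hy).1 hR (hU y hy).2 r
      rw [norm_div, div_le_iff₀ (by linarith)]
      have h3 : ‖(-1) ^ r * q ^ binom2 r * y ^ r‖ ≤ ‖q‖ ^ binom2 r * (R ^ r + R⁻¹ ^ r) := by
        simp only [norm_mul, norm_zpow, norm_neg, norm_one, one_zpow, one_mul]
        gcongr
      have h4 : 0 ≤ ‖q‖ ^ binom2 r * (R ^ r + R⁻¹ ^ r) := by positivity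
      nlinarith
  exact (hd.differentiableAt (hUo.mem_nhds hzU)).differentiableWithinAt

/-- The quasi-periodicity of the Appell sum in `z`. -/
theorem appellSum_q_mul_right {w z q : ℂ} (hq0 : q ≠ 0) (hq : ‖q‖ < 1) (hz : z ≠ 0) (hw : w ≠ 0)
    (h : ∀ k : ℤ, w ≠ q ^ k) :
    appellSum w (q * z) q = w⁻¹ * (appellSum w z q - theta z q) := by
  have h1 := (((summable_appellSum hq0 hq hz hw).hasSum).sub (hasSum_theta hz hq0 hq)).mul_left w⁻¹
  rw [← appellSum] at h1
  rw [appellSum, ← h1.tsum_eq]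
  -- Termwise this is `q^r / (1 - q^r w) = w⁻¹ (1 / (1 - q^r w) - 1)`.
  refine tsum_congr fun r => ?_
  have h2 := one_sub_zpow_mul_ne_zero h r
  rw [mul_zpow]
  field_simp
  ring

/-- The quasi-periodicity of the Appell sum in `w`. -/
theorem appellSum_q_mul_left {w z q : ℂ} (hq0 : q ≠ 0) (hq : ‖q‖ < 1) (hz : z ≠ 0) (hw : w ≠ 0)
    (h : ∀ k : ℤ, w ≠ q ^ k) :
    appellSum (q * w) z q = theta z q - q * w / z * appellSum w z q := by
  -- The index is lowered by one so that both sides have the denominator `1 - q^r w`; then `q^(-r) /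
  -- (1 - q^r w) = q^(-r) + w / (1 - q^r w)` separates a theta series.
  have h0 := (Equiv.subRight (1 : ℤ)).hasSum_iff.2 (hasSum_theta hz hq0 hq)
  have h1 := h0.sub ((summable_appellSum hq0 hq hz hw).hasSum.mul_left (q * w / z))
  rw [← appellSum] at h1
  rw [appellSum, ← h1.tsum_eq, ← (Equiv.subRight (1 : ℤ)).tsum_eq]
  refine tsum_congr fun r => ?_
  have h2 := one_sub_zpow_mul_ne_zero h r
  have hb : binom2 r = binom2 (r - 1) + (r - 1) := by
    conv_lhs => rw [← sub_add_cancel r 1, binom2_add_one]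
  have e0 : q ^ binom2 r = q ^ binom2 (r - 1) * q ^ r / q := by
    rw [hb, zpow_add₀ hq0, zpow_sub_one₀ hq0]; field_simp
  have e1 : 1 - q ^ (r - 1) * (q * w) = 1 - q ^ r * w := by
    rw [zpow_sub_one₀ hq0]; field_simp
  simp only [Function.comp, Equiv.subRight_apply]
  rw [e1, e0, zpow_sub_one₀ (show (-1 : ℂ) ≠ 0 by norm_num), zpow_sub_one₀ hz]
  field_simp
  ring

/-- The partial fraction expansion of the reciprocal of the theta function. -/
theorem theta_mul_appellSum_q {w q : ℂ} (hq0 : q ≠ 0) (hq : ‖q‖ < 1) (hw : w ≠ 0)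
    (h : ∀ k : ℤ, w ≠ q ^ k) : theta w q * appellSum w q q = qPochInf q q ^ 3 := by
  set c : ℤ → ℂ := fun r => (-1) ^ r * q ^ binom2 r * q ^ r
  have hd := differentiableOn_thetaMulSum hq0 hq (summable_norm_thetaTerm hq0 hq0 hq)
  -- At `z = q` the inhomogeneous term `Θ(z;q)` vanishes, so the product is `q`-periodic, hence
  -- constant, and its value can be read off at `1`.
  have hper : ∀ x, x ≠ 0 → thetaMulSum c q (q * x) = thetaMulSum c q x := by
    intro x hx
    have hmaps : Set.MapsTo (fun x => q * x) ({0}ᶜ : Set ℂ) {0}ᶜ := fun x hx => mul_ne_zero hq0 hx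
    refine eqOn_of_countable (f := fun x => thetaMulSum c q (q * x))
      (S := Set.range fun k : ℤ => q ^ k) (Set.countable_range _)
      (hd.continuousOn.comp (by fun_prop) hmaps) hd.continuousOn (fun y hy hyS => ?_) hx
    have hy1 : ∀ k : ℤ, y ≠ q ^ k := fun k hk => hyS ⟨k, hk.symm⟩
    have hy2 : ∀ k : ℤ, q * y ≠ q ^ k := fun k hk => hy1 (k - 1) (by
      rw [zpow_sub_one₀ hq0, ← hk]; field_simp)
    have := appellSum_q_mul_left hq0 hq hq0 hy hy1
    rw [show theta q q = 0 by simpa using theta_zpow hq0 hq 1] at this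
    rw [thetaMulSum_eq hq0 hq c hy hy1, thetaMulSum_eq hq0 hq c (mul_ne_zero hq0 hy) hy2,
      ← appellSum, ← appellSum, this, theta_q_mul hy hq0 hq]
    field_simp
    ring
  have h1 := eq_of_norm_q_mul_eq hq0 hq hd (fun x hx => by rw [hper x hx]) hw one_ne_zero
  rw [thetaMulSum_one hq0 hq, thetaMulSum_eq hq0 hq c hw h, ← appellSum] at h1
  rw [h1]
  simp

/-- The value of the Appell sum at `z = 1`. -/
theorem appellSum_one {w q : ℂ} (hq0 : q ≠ 0) (hq : ‖q‖ < 1) (hw : w ≠ 0)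
    (h : ∀ k : ℤ, w ≠ q ^ k) :
    appellSum w 1 q = w * qPochInf q q ^ 3 / theta w q := by
  have h1 := appellSum_q_mul_right hq0 hq one_ne_zero hw h
  rw [theta_one hq, sub_zero, mul_one] at h1
  rw [eq_div_iff (theta_ne_zero hq h), ← theta_mul_appellSum_q hq0 hq hw h, h1]
  field_simp

/-! ### The Hecke-type double sum -/

/-- The general term of the double sum `f_{1,2,3}(x⁻¹q²,q³;q)` without its sign factor. -/
def heckeMonomial (x q : ℂ) (p : ℤ × ℤ) : ℂ :=
  (-1) ^ (p.1 + p.2) * (x⁻¹ * q ^ 2) ^ p.1 * (q ^ 3) ^ p.2 *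
    q ^ (1 * binom2 p.1 + 2 * p.1 * p.2 + 3 * binom2 p.2)

theorem heckeTerm_eq (x q : ℂ) (p : ℤ × ℤ) :
    heckeTerm 1 2 3 (x⁻¹ * q ^ 2) (q ^ 3) q p = sg₂ p.1 p.2 * heckeMonomial x q p := by
  rw [heckeTerm, heckeMonomial]; ring

theorem zpow_le_one_of_nonneg {ρ : ℝ} (h0 : 0 < ρ) (h1 : ρ ≤ 1) {r : ℤ} (hr : 0 ≤ r) : ρ ^ r ≤ 1 := by
  lift r to ℕ using hr
  rw [zpow_natCast]
  exact pow_le_one₀ h0.le h1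

/-- The quadratic form is indefinite, but the sign factor vanishes unless `r` and `s` lie on the
same side of zero. There `rs ≥ 0`, so the cross term can be dropped and the bound is a product of
two one-variable series. -/
theorem norm_heckeTerm_le {x q : ℂ} (hq0 : q ≠ 0) (hq : ‖q‖ < 1) (p : ℤ × ℤ) :
    ‖heckeTerm 1 2 3 (x⁻¹ * q ^ 2) (q ^ 3) q p‖ ≤
      (‖q‖ ^ binom2 p.1 * (‖x‖⁻¹ * ‖q‖ ^ 2) ^ p.1) *
        ((‖q‖ ^ 3) ^ binom2 p.2 * (‖q‖ ^ 3) ^ p.2) := by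
  have hq0' : 0 < ‖q‖ := norm_pos_iff.2 hq0
  obtain ⟨r, s⟩ := p
  have hsg : ‖sg₂ r s‖ * ‖q‖ ^ (2 * r * s) ≤ 1 := by
    rcases lt_or_ge r 0 with hr | hr <;> rcases lt_or_ge s 0 with hs | hs
    · have : ‖sg₂ r s‖ = 1 := by
        simp [sg₂, sg, hr.not_ge, hs.not_ge, ← two_mul]
      rw [this, one_mul]
      exact zpow_le_one_of_nonneg hq0' hq.le (by nlinarith)
    · simp [sg₂, sg, hr.not_ge, hs]
    · simp [sg₂, sg, hr, hs.not_ge]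
    · have : ‖sg₂ r s‖ = 1 := by
        simp [sg₂, sg, hr, hs, ← two_mul]
      rw [this, one_mul]
      exact zpow_le_one_of_nonneg hq0' hq.le (by positivity)
  have e : ‖heckeTerm 1 2 3 (x⁻¹ * q ^ 2) (q ^ 3) q (r, s)‖ =
      (‖sg₂ r s‖ * ‖q‖ ^ (2 * r * s)) *
      ((‖q‖ ^ binom2 r * (‖x‖⁻¹ * ‖q‖ ^ 2) ^ r) * ((‖q‖ ^ 3) ^ binom2 s * (‖q‖ ^ 3) ^ s)) := by
    have e3 : (‖q‖ ^ 3) ^ binom2 s = ‖q‖ ^ (3 * binom2 s) := by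
      rw [zpow_mul]; norm_cast
    simp only [heckeTerm, norm_mul, norm_zpow, norm_neg, norm_one, one_zpow, norm_inv, norm_pow]
    rw [e3, zpow_add₀ hq0'.ne', zpow_add₀ hq0'.ne', one_mul (binom2 r)]
    ring
  rw [e]
  exact mul_le_of_le_one_left (by positivity) hsg

theorem summable_heckeTerm {x q : ℂ} (hx : x ≠ 0) (hq0 : q ≠ 0) (hq : ‖q‖ < 1) :
    Summable (heckeTerm 1 2 3 (x⁻¹ * q ^ 2) (q ^ 3) q) := by
  have hq0' : 0 < ‖q‖ := norm_pos_iff.2 hq0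
  have hx' : 0 < ‖x‖ := norm_pos_iff.2 hx
  refine Summable.of_norm_bounded (Summable.mul_of_nonneg
    (summable_gauss hq0' hq (R := ‖x‖⁻¹ * ‖q‖ ^ 2) (by positivity))
    (summable_gauss (ρ := ‖q‖ ^ 3) (by positivity) (pow_lt_one₀ hq0'.le hq (by norm_num))
      (R := ‖q‖ ^ 3) (by positivity)) (fun r => by positivity) (fun r => by positivity))
    (norm_heckeTerm_le hq0 hq)

theorem differentiableOn_hecke {q : ℂ} (hq0 : q ≠ 0) (hq : ‖q‖ < 1) :
    DifferentiableOn ℂ (fun x => hecke 1 2 3 (x⁻¹ * q ^ 2) (q ^ 3) q) {0}ᶜ := by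
  intro x hx
  have hq0' : 0 < ‖q‖ := norm_pos_iff.2 hq0
  obtain ⟨R, hR, U, hUo, hxU, hU0, hU⟩ := exists_annulus_nhds hx
  have hsum : Summable fun r : ℤ => ‖q‖ ^ binom2 r * ((R ^ r + R⁻¹ ^ r) * (‖q‖ ^ 2) ^ r) := by
    refine ((summable_gauss hq0' hq (R := R * ‖q‖ ^ 2) (by positivity)).add
      (summable_gauss hq0' hq (R := R⁻¹ * ‖q‖ ^ 2) (by positivity))).congr fun r => ?_
    rw [mul_zpow, mul_zpow]; ring
  have hd : DifferentiableOn ℂ (fun x => hecke 1 2 3 (x⁻¹ * q ^ 2) (q ^ 3) q) U := by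
    refine differentiableOn_tsum_of_eventually hUo (Summable.mul_of_nonneg hsum
      (summable_gauss (ρ := ‖q‖ ^ 3) (by positivity) (pow_lt_one₀ hq0'.le hq (by norm_num))
        (R := ‖q‖ ^ 3) (by positivity)) (fun r => by positivity) (fun r => by positivity))
      (fun p y hy => ?_) (Eventually.of_forall fun p y hy => ?_)
    · have hy0 : y ≠ 0 := hU0 hy
      have h1 : DifferentiableAt ℂ (fun y : ℂ => (y⁻¹ * q ^ 2) ^ p.1) y :=
        DifferentiableAt.zpow (by fun_prop (disch := assumption))
          (Or.inl (mul_ne_zero (inv_ne_zero hy0) (pow_ne_zero 2 hq0)))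
      simp only [heckeTerm]
      exact (((h1.const_mul _).mul_const _).mul_const _).differentiableWithinAt
    · refine (norm_heckeTerm_le hq0 hq p).trans ?_
      have hy0 : 0 < ‖y‖ := norm_pos_iff.2 (hU0 hy)
      have h1 := zpow_le_add_inv (t := ‖y‖⁻¹) (inv_anti₀ hy0 (hU y hy).2) hR
        ((inv_le_comm₀ hy0 hR).2 (hU y hy).1) p.1
      rw [mul_zpow]
      gcongr
  exact (hd.differentiableAt (hUo.mem_nhds hxU)).differentiableWithinAt

/-- The shift `(-3, 2)` is the one for which the linear part of the change in the quadratic exponent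
is exactly `r`: the `s` contributions cancel, and `q^r` is absorbed by replacing `x` with `qx`. -/
theorem heckeMonomial_shift {x q : ℂ} (hx : x ≠ 0) (hq0 : q ≠ 0) (r s : ℤ) :
    heckeMonomial (q * x) q (r - 3, s + 2) = -x ^ 3 * heckeMonomial x q (r, s) := by
  have h1 : binom2 (r - 3) = binom2 r - 3 * r + 6 := by
    have := binom2_add r (-3)
    rw [← sub_eq_add_neg, show binom2 (-3) = 6 by rfl] at this
    linarith
  have h2 : binom2 (s + 2) = binom2 s + 2 * s + 1 := by
    have := binom2_add s 2
    rw [show binom2 2 = 1 by rfl] at this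
    linarith
  have e : ∀ (x : ℂ) (r s : ℤ), x ≠ 0 → heckeMonomial x q (r, s) =
      (-1) ^ (r + s) * x ^ (-r) * q ^ (2 * r + 3 * s + binom2 r + 2 * r * s + 3 * binom2 s) := by
    intro x r s hx
    have h3 : (q ^ 3) ^ s = q ^ (3 * s) := by rw [zpow_mul]; norm_cast
    have h4 : (q ^ 2) ^ r = q ^ (2 * r) := by rw [zpow_mul]; norm_cast
    rw [heckeMonomial, mul_zpow, inv_zpow, ← zpow_neg, h3, h4]
    simp only [one_mul]
    rw [show 2 * r + 3 * s + binom2 r + 2 * r * s + 3 * binom2 s =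
      2 * r + (3 * s + (binom2 r + 2 * r * s + 3 * binom2 s)) by ring, zpow_add₀ hq0 (2 * r),
      zpow_add₀ hq0 (3 * s)]
    ring
  rw [e _ _ _ (mul_ne_zero hq0 hx), e _ _ _ hx, h1, h2, mul_zpow,
    show r - 3 + (s + 2) = r + s + (-1) by ring, zpow_add₀ (show (-1 : ℂ) ≠ 0 by norm_num),
    show -(r - 3) = -r + 3 by ring, zpow_add₀ hx,
    show 2 * r + 3 * s + binom2 r + 2 * r * s + 3 * binom2 s =
      (-r + 3) + (2 * (r - 3) + 3 * (s + 2) + (binom2 r - 3 * r + 6) + 2 * (r - 3) * (s + 2) +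
        3 * (binom2 s + 2 * s + 1)) by ring, zpow_add₀ hq0 (-r + 3)]
  norm_num
  ring

/-- Writing a row as a sum over all of `ℤ × ℤ` lets the row corrections be subtracted termwise from
the double sum. -/
theorem hasSum_prod_singleton_left {f : ℤ × ℤ → ℂ} (r : ℤ) {a : ℂ}
    (h : HasSum (fun s => f (r, s)) a) : HasSum (fun p : ℤ × ℤ => if p.1 = r then f p else 0) a := by
  have hi : Function.Injective fun s : ℤ => (r, s) := fun s t h => (Prod.ext_iff.1 h).2
  refine (hi.hasSum_iff ?_).1 ?_
  · rintro ⟨r', s⟩ hp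
    rw [if_neg]
    rintro rfl
    exact hp ⟨s, rfl⟩
  · simpa [Function.comp_def] using h

theorem hasSum_prod_singleton_right {f : ℤ × ℤ → ℂ} (s : ℤ) {a : ℂ}
    (h : HasSum (fun r => f (r, s)) a) : HasSum (fun p : ℤ × ℤ => if p.2 = s then f p else 0) a := by
  have hi : Function.Injective fun r : ℤ => (r, s) := fun s t h => (Prod.ext_iff.1 h).1
  refine (hi.hasSum_iff ?_).1 ?_
  · rintro ⟨r, s'⟩ hp
    rw [if_neg]
    rintro rfl
    exact hp ⟨r, rfl⟩
  · simpa [Function.comp_def] using h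

theorem hasSum_heckeMonomial_row {x q : ℂ} (hq0 : q ≠ 0) (hq : ‖q‖ < 1) (r : ℤ) :
    HasSum (fun s => heckeMonomial x q (r, s))
      ((-1) ^ r * (x⁻¹ * q ^ 2) ^ r * q ^ binom2 r * theta (q ^ (2 * r + 3)) (q ^ 3)) := by
  have hq3 : ‖q ^ 3‖ < 1 := by
    rw [norm_pow]; exact pow_lt_one₀ (norm_nonneg q) hq (by norm_num)
  refine ((hasSum_theta (zpow_ne_zero (2 * r + 3) hq0) (pow_ne_zero 3 hq0) hq3).mul_left
    ((-1) ^ r * (x⁻¹ * q ^ 2) ^ r * q ^ binom2 r)).congr_fun fun s => ?_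
  have h3 : ∀ s : ℤ, (q ^ 3) ^ s = q ^ (3 * s) := fun s => by rw [zpow_mul]; norm_cast
  rw [heckeMonomial, h3, h3, ← zpow_mul, zpow_add₀ (show (-1 : ℂ) ≠ 0 by norm_num), zpow_add₀ hq0,
    zpow_add₀ hq0, one_mul, add_mul, zpow_add₀ hq0]
  ring

theorem hasSum_heckeMonomial_col {x q : ℂ} (hx : x ≠ 0) (hq0 : q ≠ 0) (hq : ‖q‖ < 1) (s : ℤ) :
    HasSum (fun r => heckeMonomial x q (r, s))
      ((-1) ^ s * (q ^ 3) ^ s * q ^ (3 * binom2 s) * theta (x⁻¹ * q ^ (2 * s + 2)) q) := by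
  refine ((hasSum_theta (mul_ne_zero (inv_ne_zero hx) (zpow_ne_zero (2 * s + 2) hq0)) hq0 hq).mul_left
    ((-1) ^ s * (q ^ 3) ^ s * q ^ (3 * binom2 s))).congr_fun fun r => ?_
  have h2 : ∀ s : ℤ, (q ^ 2) ^ s = q ^ (2 * s) := fun s => by rw [zpow_mul]; norm_cast
  rw [heckeMonomial, mul_zpow, mul_zpow, h2, ← zpow_mul, zpow_add₀ (show (-1 : ℂ) ≠ 0 by norm_num),
    zpow_add₀ hq0, zpow_add₀ hq0, one_mul, add_mul, zpow_add₀ hq0,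
    show 2 * s * r = 2 * r * s by ring]
  ring

/-- Splitting an infinite product into residue classes. -/
theorem qPochInf_eq_prod (x : ℂ) {q : ℂ} (hq : ‖q‖ < 1) {m : ℕ} (hm : m ≠ 0) :
    qPochInf x q = ∏ j ∈ Finset.range m, qPochInf (x * q ^ j) (q ^ m) := by
  have hqm : ‖q ^ m‖ < 1 := by rw [norm_pow]; exact pow_lt_one₀ (norm_nonneg q) hq hm
  have hfin : ∀ n, qPoch x q (m * n) = ∏ j ∈ Finset.range m, qPoch (x * q ^ j) (q ^ m) n := by
    intro n
    induction n with
    | zero => simp [qPoch]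
    | succ n ih =>
      rw [mul_add_one, qPoch, Finset.prod_range_add, ← qPoch, ih, ← Finset.prod_mul_distrib]
      refine Finset.prod_congr rfl fun j _ => ?_
      rw [qPoch, qPoch, Finset.prod_range_succ]
      ring
  have h1 : Tendsto (fun n => qPoch x q (m * n)) atTop (𝓝 (qPochInf x q)) :=
    (tendsto_qPoch x hq).comp (tendsto_id.const_mul_atTop' (Nat.pos_of_ne_zero hm))
  simp_rw [hfin] at h1
  exact tendsto_nhds_unique h1 (tendsto_finsetProd _ fun j _ => tendsto_qPoch _ hqm)

/-- `Θ(q;q³) = (q;q)_∞`. -/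
theorem theta_q_cube {q : ℂ} (hq0 : q ≠ 0) (hq : ‖q‖ < 1) : theta q (q ^ 3) = qPochInf q q := by
  rw [qPochInf_eq_prod q hq three_ne_zero, theta]
  simp only [Finset.prod_range_succ, Finset.prod_range_zero, one_mul, pow_zero, mul_one, pow_one]
  rw [show q ^ 3 / q = q * q by field_simp, show q * q ^ 2 = q ^ 3 by ring]

/-- The functional equation of the double sum. -/
theorem hecke_q_mul {x q : ℂ} (hx : x ≠ 0) (hq0 : q ≠ 0) (hq : ‖q‖ < 1) :
    hecke 1 2 3 ((q * x)⁻¹ * q ^ 2) (q ^ 3) q =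
      -x ^ 3 * hecke 1 2 3 (x⁻¹ * q ^ 2) (q ^ 3) q
        + qPochInf q q * (x + x ^ 2) + (1 - x ^ 2) * theta x q := by
  have hq3 : ‖q ^ 3‖ < 1 := by
    rw [norm_pow]; exact pow_lt_one₀ (norm_nonneg q) hq (by norm_num)
  have hq30 := pow_ne_zero 3 hq0
  have hJ := theta_q_cube hq0 hq
  -- The shift corrects rows `r = 0, 1, 2`, with theta values at `q³`, `q⁵`, `q⁷` in base `q³` (row
  -- `0` contributes nothing), and columns `s = -1, -2`.
  have t0 : theta (q ^ 3) (q ^ 3) = 0 := by simpa using theta_zpow hq30 hq3 1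
  have t2 : theta (q ^ 2) (q ^ 3) = qPochInf q q := by
    rw [← hJ, ← theta_div _ _ hq30]; congr 1; field_simp
  have t5 : theta (q ^ 5) (q ^ 3) = -(q ^ 2)⁻¹ * qPochInf q q := by
    rw [← t2, ← theta_q_mul (pow_ne_zero 2 hq0) hq30 hq3]; congr 1; ring
  have t7 : theta (q ^ 7) (q ^ 3) = (q ^ 5)⁻¹ * qPochInf q q := by
    rw [show q ^ 7 = q ^ 3 * (q ^ 3 * q) by ring, theta_q_mul (mul_ne_zero hq30 hq0) hq30 hq3,
      theta_q_mul hq0 hq30 hq3, hJ]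
    field_simp
  have c1 : theta (x⁻¹ * q ^ (2 * (-1 : ℤ) + 2)) q = -x⁻¹ * theta x q := by
    rw [← theta_inv hx hq0 hq]; norm_num
  have c2 : theta (x⁻¹ * q ^ (2 * (-2 : ℤ) + 2)) q = -x⁻¹ ^ 3 * (q ^ 3)⁻¹ * theta x q := by
    have h1 := theta_zpow_mul (inv_ne_zero hx) hq0 hq (-2)
    rw [theta_inv hx hq0 hq, show binom2 (-2) = 3 by rfl, mul_comm (q ^ (-2 : ℤ))] at h1
    norm_num at h1 ⊢
    field_simp at h1 ⊢
    rw [← h1]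
  have r0 := hasSum_prod_singleton_left 0 (hasSum_heckeMonomial_row (x := x) hq0 hq 0)
  have r1 := hasSum_prod_singleton_left 1 (hasSum_heckeMonomial_row (x := x) hq0 hq 1)
  have r2 := hasSum_prod_singleton_left 2 (hasSum_heckeMonomial_row (x := x) hq0 hq 2)
  have s1 := hasSum_prod_singleton_right (-1) (hasSum_heckeMonomial_col hx hq0 hq (-1))
  have s2 := hasSum_prod_singleton_right (-2) (hasSum_heckeMonomial_col hx hq0 hq (-2))
  have hF := (summable_heckeTerm hx hq0 hq).hasSum
  have hall := (hF.sub (((r0.add r1).add r2).sub (s1.add s2))).mul_left (-x ^ 3)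
  have hG := (summable_heckeTerm (mul_ne_zero hq0 hx) hq0 hq).hasSum
  rw [← ((Equiv.subRight (3 : ℤ)).prodCongr (Equiv.addRight (2 : ℤ))).hasSum_iff] at hG
  have hfun : (heckeTerm 1 2 3 ((q * x)⁻¹ * q ^ 2) (q ^ 3) q ∘
      ((Equiv.subRight (3 : ℤ)).prodCongr (Equiv.addRight (2 : ℤ)))) = fun p : ℤ × ℤ =>
      -x ^ 3 * (heckeTerm 1 2 3 (x⁻¹ * q ^ 2) (q ^ 3) q p -
        (((if p.1 = 0 then heckeMonomial x q p else 0) +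
          (if p.1 = 1 then heckeMonomial x q p else 0) +
          (if p.1 = 2 then heckeMonomial x q p else 0)) -
        ((if p.2 = -1 then heckeMonomial x q p else 0) +
          (if p.2 = -2 then heckeMonomial x q p else 0)))) := by
    funext ⟨r, s⟩
    simp only [Function.comp, Equiv.prodCongr_apply, Prod.map, Equiv.subRight_apply,
      Equiv.coe_addRight, heckeTerm_eq, heckeMonomial_shift hx hq0]
    -- The sign changes precisely at the indices that cross zero under the shift; these are the
    -- correcting rows and, below, columns.
    have hr : sg (r - 3) = sg r - 2 * ((if r = 0 then 1 else 0) + (if r = 1 then 1 else 0) +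
        (if r = 2 then 1 else 0)) := by
      simp only [sg]; split_ifs <;> first | omega | norm_num
    have hs : sg (s + 2) = sg s + 2 * ((if s = -1 then 1 else 0) + (if s = -2 then 1 else 0)) := by
      simp only [sg]; split_ifs <;> first | omega | norm_num
    simp only [sg₂, hr, hs]
    split_ifs <;> ring
  rw [hfun] at hG
  have := hG.unique hall
  rw [hecke, this, ← hecke, c1, c2]
  norm_num [show binom2 2 = 1 by rfl, show binom2 (-1) = 1 by rfl, show binom2 (-2) = 3 by rfl]
  rw [t0, t5, t7]
  field_simp
  ring

/-! ### The universal mock theta function -/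

/-- The general term of the universal mock theta function multiplied by `Θ(x;q)`. -/
def thetaUmtTerm (q : ℂ) (n : ℕ) (x : ℂ) : ℂ :=
  q ^ (n ^ 2) * qPochInf (x * q ^ (n + 1)) q * qPochInf (q ^ (n + 1) / x) q * qPochInf q q

theorem theta_mul_umtTerm {x q : ℂ} (hq : ‖q‖ < 1) (h : theta x q ≠ 0) (n : ℕ) :
    theta x q * umtTerm x q n = thetaUmtTerm q n x := by
  have h1 := qPochInf_eq_qPoch_mul x hq (n + 1)
  have h2 := qPochInf_eq_qPoch_mul (q / x) hq n
  rw [show q / x * q ^ n = q ^ (n + 1) / x by ring] at h2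
  rw [theta, h1, h2] at h ⊢
  have h3 : qPoch x q (n + 1) ≠ 0 := by rintro h0; simp [h0] at h
  have h4 : qPoch (q / x) q n ≠ 0 := by rintro h0; simp [h0] at h
  rw [umtTerm, thetaUmtTerm]
  field_simp

theorem exists_norm_thetaUmtTerm_le {q : ℂ} (hq : ‖q‖ < 1) {R : ℝ} (hR : 0 < R) :
    ∃ C : ℝ, ∀ (n : ℕ) (x : ℂ), R⁻¹ ≤ ‖x‖ → ‖x‖ ≤ R → ‖thetaUmtTerm q n x‖ ≤ ‖q‖ ^ n * C := by
  obtain ⟨C, hC0, hC⟩ := exists_norm_qPochInf_le hq R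
  refine ⟨C * C * ‖qPochInf q q‖, fun n x h1 h2 => ?_⟩
  have hx : 0 < ‖x‖ := (inv_pos.2 hR).trans_le h1
  have hqn : ‖q ^ (n + 1)‖ ≤ 1 := by
    rw [norm_pow]; exact pow_le_one₀ (norm_nonneg q) hq.le
  have e1 : ‖x * q ^ (n + 1)‖ ≤ R := by
    rw [norm_mul]
    exact (mul_le_of_le_one_right hx.le hqn).trans h2
  have e2 : ‖q ^ (n + 1) / x‖ ≤ R := by
    rw [norm_div, div_eq_mul_inv]
    exact (mul_le_of_le_one_left (by positivity) hqn).trans ((inv_le_comm₀ hx hR).2 h1)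
  have e3 : ‖q‖ ^ (n ^ 2) ≤ ‖q‖ ^ n :=
    pow_le_pow_of_le_one (norm_nonneg q) hq.le (Nat.le_self_pow two_ne_zero n)
  rw [thetaUmtTerm, norm_mul, norm_mul, norm_mul, norm_pow]
  calc ‖q‖ ^ n ^ 2 * ‖qPochInf (x * q ^ (n + 1)) q‖ * ‖qPochInf (q ^ (n + 1) / x) q‖ *
        ‖qPochInf q q‖ ≤ ‖q‖ ^ n * C * C * ‖qPochInf q q‖ := by
        gcongr
        · exact hC _ e1
        · exact hC _ e2
    _ = ‖q‖ ^ n * (C * C * ‖qPochInf q q‖) := by ring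

theorem summable_thetaUmtTerm {x q : ℂ} (hq : ‖q‖ < 1) (hx : x ≠ 0) :
    Summable fun n => thetaUmtTerm q n x := by
  obtain ⟨R, hR, U, -, hxU, -, hU⟩ := exists_annulus_nhds hx
  obtain ⟨C, hC⟩ := exists_norm_thetaUmtTerm_le hq hR
  exact Summable.of_norm_bounded ((summable_geometric_of_lt_one (norm_nonneg q) hq).mul_right C)
    fun n => hC n x (hU x hxU).1 (hU x hxU).2

/-- The holomorphic function `Θ(x;q) ∑ q^{n²} / ((x;q)_{n+1} (q/x;q)_n)`. -/
def thetaUmt (q x : ℂ) : ℂ := ∑' n : ℕ, thetaUmtTerm q n x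

theorem differentiableOn_thetaUmt {q : ℂ} (hq : ‖q‖ < 1) :
    DifferentiableOn ℂ (thetaUmt q) {0}ᶜ := by
  intro x hx
  obtain ⟨R, hR, U, hUo, hxU, hU0, hU⟩ := exists_annulus_nhds hx
  obtain ⟨C, hC⟩ := exists_norm_thetaUmtTerm_le hq hR
  have h := differentiable_qPochInf hq
  have hd : DifferentiableOn ℂ (thetaUmt q) U := by
    refine Complex.differentiableOn_tsum_of_summable_norm
      ((summable_geometric_of_lt_one (norm_nonneg q) hq).mul_right C) (fun n y hy => ?_) hUo
      fun n y hy => hC n y (hU y hy).1 (hU y hy).2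
    have hy0 : y ≠ 0 := hU0 hy
    exact (((((h _).comp y (f := fun x => x * q ^ (n + 1)) (by fun_prop)).const_mul _).mul
      ((h _).comp y (f := fun x => q ^ (n + 1) / x) (by fun_prop (disch := assumption)))).mul_const
      _).differentiableWithinAt
  exact (hd.differentiableAt (hUo.mem_nhds hxU)).differentiableWithinAt

theorem summable_umtTerm {x q : ℂ} (hq : ‖q‖ < 1) (hx : x ≠ 0) (h : theta x q ≠ 0) :
    Summable (umtTerm x q) := by
  refine ((summable_thetaUmtTerm hq hx).mul_left (theta x q)⁻¹).congr fun n => ?_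
  rw [← theta_mul_umtTerm hq h, inv_mul_cancel_left₀ h]

theorem theta_mul_umt {x q : ℂ} (hq : ‖q‖ < 1) (h : theta x q ≠ 0) :
    theta x q * umt x q = x⁻¹ * (thetaUmt q x - theta x q) := by
  have : thetaUmt q x = theta x q * ∑' n, umtTerm x q n := by
    rw [← tsum_mul_left]
    exact tsum_congr fun n => (theta_mul_umtTerm hq h n).symm
  rw [this, umt]; ring

/-- The functional equation holds termwise up to a difference in `n`. After summation only the
boundary term at `n = 0` remains, and `(1 - x)` times the term with `n = 0` is `Θ(x;q)`. -/
theorem thetaUmtTerm_telescope {x q : ℂ} (hq : ‖q‖ < 1) (hq0 : q ≠ 0) (hx : x ≠ 0) (n : ℕ) :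
    -x * thetaUmtTerm q n (q * x) + q * x ^ 3 * thetaUmtTerm q n x =
      (1 - q * x ^ 2) * ((x - q ^ (n + 1)) * thetaUmtTerm q (n + 1) x -
        (x - q ^ n) * thetaUmtTerm q n x) := by
  have h1 := qPochInf_eq_mul (x * q ^ (n + 1)) hq
  have h2 := qPochInf_eq_mul (q ^ n / x) hq
  have h3 := qPochInf_eq_mul (q ^ (n + 1) / x) hq
  rw [show x * q ^ (n + 1) * q = x * q ^ (n + 2) by ring] at h1
  rw [show q ^ n / x * q = q ^ (n + 1) / x by ring] at h2
  rw [show q ^ (n + 1) / x * q = q ^ (n + 2) / x by ring] at h3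
  rw [thetaUmtTerm, thetaUmtTerm, thetaUmtTerm,
    show q * x * q ^ (n + 1) = x * q ^ (n + 2) by ring,
    show q ^ (n + 1) / (q * x) = q ^ n / x by rw [pow_succ]; field_simp, h2, h1,
    show n + 1 + 1 = n + 2 by ring]
  have h4 : (x - q ^ (n + 1)) * (q ^ (n + 1) ^ 2 * qPochInf (x * q ^ (n + 2)) q *
      qPochInf (q ^ (n + 2) / x) q * qPochInf q q) = x * (q ^ (n + 1) ^ 2 *
      qPochInf (x * q ^ (n + 2)) q * qPochInf (q ^ (n + 1) / x) q * qPochInf q q) := by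
    rw [h3]; field_simp
  rw [h4, show q ^ (n + 1) ^ 2 = q ^ n ^ 2 * (q ^ n) ^ 2 * q by ring, pow_succ q n]
  field_simp
  ring

theorem thetaUmt_q_mul {x q : ℂ} (hq : ‖q‖ < 1) (hq0 : q ≠ 0) (hx : x ≠ 0) :
    -x * thetaUmt q (q * x) + q * x ^ 3 * thetaUmt q x = (1 - q * x ^ 2) * theta x q := by
  have s1 := summable_thetaUmtTerm hq hx
  have h1 := ((summable_thetaUmtTerm hq (mul_ne_zero hq0 hx)).hasSum.mul_left (-x)).add
    (s1.hasSum.mul_left (q * x ^ 3))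
  have h2 := h1.tendsto_sum_nat
  simp_rw [thetaUmtTerm_telescope hq hq0 hx, ← Finset.mul_sum,
    Finset.sum_range_sub (fun n => (x - q ^ n) * thetaUmtTerm q n x)] at h2
  have h3 : Tendsto (fun n : ℕ => (x - q ^ n) * thetaUmtTerm q n x) atTop (𝓝 0) := by
    simpa using ((tendsto_pow_atTop_nhds_zero_of_norm_lt_one hq).const_sub x).mul
      s1.tendsto_atTop_zero
  have h4 := tendsto_nhds_unique h2 ((h3.sub_const _).const_mul (1 - q * x ^ 2))
  rw [thetaUmt, thetaUmt, h4, theta, qPochInf_eq_mul x hq, thetaUmtTerm]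
  simp
  ring

/-! ### Special values -/

theorem norm_pow_lt_one {q : ℂ} (hq : ‖q‖ < 1) {m : ℕ} (hm : m ≠ 0) : ‖q ^ m‖ < 1 := by
  rw [norm_pow]; exact pow_lt_one₀ (norm_nonneg q) hq hm

theorem qPochInf_neg_ne_zero {q : ℂ} (hq : ‖q‖ < 1) : qPochInf (-q) q ≠ 0 :=
  qPochInf_ne_zero_of_norm_lt hq (by rwa [norm_neg])

theorem theta_neg_one {q : ℂ} (hq : ‖q‖ < 1) :
    theta (-1) q = 2 * qPochInf (-q) q ^ 2 * qPochInf q q := by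
  rw [theta, qPochInf_eq_mul (-1) hq, div_neg, div_one, neg_one_mul]
  ring

theorem theta_neg_one_ne_zero {q : ℂ} (hq : ‖q‖ < 1) : theta (-1) q ≠ 0 := by
  rw [theta_neg_one hq]
  exact mul_ne_zero (mul_ne_zero two_ne_zero (pow_ne_zero 2 (qPochInf_neg_ne_zero hq)))
    (qPochInf_ne_zero_of_norm_lt hq hq)

theorem theta_neg_q_sq {q : ℂ} (hq0 : q ≠ 0) :
    theta (-q) (q ^ 2) = qPochInf (-q) (q ^ 2) ^ 2 * qPochInf (q ^ 2) (q ^ 2) := by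
  rw [theta, show q ^ 2 / -q = -q by field_simp]; ring

theorem qPochInf_split_two (x : ℂ) {q : ℂ} (hq : ‖q‖ < 1) :
    qPochInf x q = qPochInf x (q ^ 2) * qPochInf (x * q) (q ^ 2) := by
  rw [qPochInf_eq_prod x hq two_ne_zero]
  simp [Finset.prod_range_succ]

/-- The constant of the theta quotient in the expansion of the double sum. -/
theorem thetaConstant_eq {q : ℂ} (hq0 : q ≠ 0) (hq : ‖q‖ < 1) :
    qPochInf (q ^ 2) (q ^ 2) ^ 3 * theta q (q ^ 2) / (theta (-1) (q ^ 2) * theta (-q) (q ^ 2)) =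
      qPochInf q q ^ 2 / (2 * qPochInf (-q) q ^ 2) := by
  have hq2 := norm_pow_lt_one hq two_ne_zero
  have h1 := qPochInf_split_two q hq
  have h2 := qPochInf_split_two (-q) hq
  have hP := qPochInf_neg_ne_zero hq
  have hJ := qPochInf_ne_zero_of_norm_lt hq2 hq2
  rw [neg_mul, ← sq] at h2
  rw [← sq] at h1
  rw [theta_neg_one hq2, theta_neg_q_sq hq0, theta, show q ^ 2 / q = q by field_simp]
  rw [h2] at hP ⊢
  rw [h1]
  have h3 := left_ne_zero_of_mul hP
  have h4 := right_ne_zero_of_mul hP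
  field_simp

theorem theta_neg_cube {q : ℂ} (hq0 : q ≠ 0) (hq : ‖q‖ < 1) :
    theta (-q) (q ^ 3) * qPochInf (-q ^ 3) (q ^ 3) =
      qPochInf (-q) q * qPochInf (q ^ 3) (q ^ 3) := by
  rw [qPochInf_eq_prod (-q) hq three_ne_zero, theta]
  simp only [Finset.prod_range_succ, Finset.prod_range_zero, one_mul, pow_zero, mul_one, pow_one]
  rw [show q ^ 3 / -q = -q * q by field_simp, show -q * q ^ 2 = -q ^ 3 by ring]
  ring

theorem neg_zpow_ne {q : ℂ} (hq0 : q ≠ 0) (hq : ‖q‖ < 1) {m : ℤ} (hm : ¬ 3 ∣ m) (k : ℤ) :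
    -q ^ m ≠ (q ^ 3) ^ k := by
  intro h
  have h1 : ‖q‖ ^ m = ‖q‖ ^ (3 * k) := by
    rw [← norm_zpow, ← norm_neg, h, zpow_mul, norm_zpow, norm_pow]
    norm_cast
  have h2 := (zpow_right_inj₀ (norm_pos_iff.2 hq0) hq.ne).1 h1
  exact hm ⟨k, h2⟩

theorem neg_inv_ne {q : ℂ} (hq0 : q ≠ 0) (hq : ‖q‖ < 1) (k : ℤ) : -q⁻¹ ≠ (q ^ 3) ^ k := by
  simpa using neg_zpow_ne hq0 hq (m := -1) (by decide) k

theorem neg_inv_sq_ne {q : ℂ} (hq0 : q ≠ 0) (hq : ‖q‖ < 1) (k : ℤ) :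
    -(q ^ 2)⁻¹ ≠ (q ^ 3) ^ k := by
  have := neg_zpow_ne hq0 hq (m := -2) (by decide) k
  rwa [zpow_neg, show q ^ (2 : ℤ) = q ^ 2 by norm_cast] at this

/-- By `appellSum_one` and quasi-periodicity the value is `-(q³;q³)_∞³ / Θ(-q²;q³)`, and `Θ(-q²;q³)
= Θ(-q;q³)`. The value at `-q⁻²` therefore agrees with it. -/
theorem appellSum_neg_inv_one {q : ℂ} (hq0 : q ≠ 0) (hq : ‖q‖ < 1) :
    appellSum (-q⁻¹) 1 (q ^ 3) =
      -qPochInf (q ^ 3) (q ^ 3) ^ 2 * qPochInf (-q ^ 3) (q ^ 3) / qPochInf (-q) q := by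
  have hq3 := norm_pow_lt_one hq three_ne_zero
  have hq30 := pow_ne_zero 3 hq0
  have hu : -q⁻¹ ≠ 0 := neg_ne_zero.2 (inv_ne_zero hq0)
  have hP := qPochInf_neg_ne_zero hq
  have hθ := theta_ne_zero hq3 (neg_inv_ne hq0 hq)
  have h1 := theta_q_mul hu hq30 hq3
  rw [show q ^ 3 * -q⁻¹ = q ^ 3 / -q by field_simp, theta_div _ _ hq30] at h1
  have h2 := theta_neg_cube hq0 hq
  rw [appellSum_one hq30 hq3 hu (neg_inv_ne hq0 hq), div_eq_div_iff hθ hP]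
  rw [h1] at h2
  field_simp at h2 ⊢
  linear_combination qPochInf (q ^ 3) (q ^ 3) ^ 2 * h2

theorem appellSum_neg_inv_sq_one {q : ℂ} (hq0 : q ≠ 0) (hq : ‖q‖ < 1) :
    appellSum (-(q ^ 2)⁻¹) 1 (q ^ 3) =
      -qPochInf (q ^ 3) (q ^ 3) ^ 2 * qPochInf (-q ^ 3) (q ^ 3) / qPochInf (-q) q := by
  have hq3 := norm_pow_lt_one hq three_ne_zero
  have hq30 := pow_ne_zero 3 hq0
  have hu : -(q ^ 2)⁻¹ ≠ 0 := neg_ne_zero.2 (inv_ne_zero (pow_ne_zero 2 hq0))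
  have hP := qPochInf_neg_ne_zero hq
  have hθ := theta_ne_zero hq3 (neg_inv_sq_ne hq0 hq)
  have h1 := theta_q_mul hu hq30 hq3
  rw [show q ^ 3 * -(q ^ 2)⁻¹ = -q by field_simp] at h1
  have h2 := theta_neg_cube hq0 hq
  rw [appellSum_one hq30 hq3 hu (neg_inv_sq_ne hq0 hq), div_eq_div_iff hθ hP]
  rw [h1] at h2
  field_simp at h2 ⊢
  linear_combination qPochInf (q ^ 3) (q ^ 3) ^ 2 * h2

theorem qPochInf_cube {q ω : ℂ} (hq : ‖q‖ < 1) (hω : ω ^ 2 + ω + 1 = 0) (y : ℂ) :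
    qPochInf y q * qPochInf (ω * y) q * qPochInf (ω ^ 2 * y) q = qPochInf (y ^ 3) (q ^ 3) := by
  have h0 := multipliable_qPochInf y q hq
  have h1 := multipliable_qPochInf (ω * y) q hq
  have h2 := multipliable_qPochInf (ω ^ 2 * y) q hq
  simp only [qPochInf]
  rw [← h0.tprod_mul h1, ← (h0.mul h1).tprod_mul h2]
  refine tprod_congr fun i => ?_
  have e1 : ω ^ 2 = -ω - 1 := by linear_combination hω
  have e2 : ω ^ 3 = 1 := by linear_combination (ω - 1) * hω
  linear_combination (-(y * q ^ i) + (y * q ^ i) ^ 2 * ω) * hω - (y * q ^ i) ^ 3 * e2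

/-- If `a` is a nonreal cube root of `-1`, then `ω = -a` is a primitive cube root of unity. This and
`theta_neg_omega` evaluate `Θ(-a;q)` and `Θ(a;q)` when the zeros are checked. -/
theorem theta_omega {q ω : ℂ} (hq : ‖q‖ < 1) (hω : ω ^ 2 + ω + 1 = 0) :
    theta ω q = (1 - ω) * qPochInf (q ^ 3) (q ^ 3) := by
  have hω0 : ω ≠ 0 := by rintro rfl; norm_num at hω
  have e : q / ω = ω ^ 2 * q := by
    rw [div_eq_iff hω0]; linear_combination -(ω - 1) * q * hω
  rw [theta_eq_mul_thetaReg _ hq, thetaReg, e, ← qPochInf_cube hq hω]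
  ring

theorem theta_neg_omega {q ω : ℂ} (hq : ‖q‖ < 1) (hω : ω ^ 2 + ω + 1 = 0) :
    theta (-ω) q * qPochInf (-q) q =
      (1 + ω) * qPochInf (-q ^ 3) (q ^ 3) * qPochInf q q := by
  have hω0 : ω ≠ 0 := by rintro rfl; norm_num at hω
  have e : q / -ω = ω ^ 2 * -q := by
    rw [div_eq_iff (neg_ne_zero.2 hω0)]; linear_combination -(ω - 1) * q * hω
  have h := qPochInf_cube hq hω (-q)
  rw [show (-q) ^ 3 = -q ^ 3 by ring] at h
  rw [theta_eq_mul_thetaReg _ hq, thetaReg, e, ← h, neg_mul, mul_neg ω]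
  ring

/-! ### The two expansions -/

/-- The numerator `Θ(-x³;q³) (x⁻¹ m(x⁻³q²,-x³;q³) + x⁻² m(x⁻³q,-x³;q³))`. -/
def appellPair (q x : ℂ) : ℂ :=
  x⁻¹ * appellSum (-q⁻¹) (-x ^ 3) (q ^ 3) + x⁻¹ ^ 2 * appellSum (-(q ^ 2)⁻¹) (-x ^ 3) (q ^ 3)

theorem neg_cube_mapsTo : Set.MapsTo (fun x : ℂ => -x ^ 3) {0}ᶜ {0}ᶜ :=
  fun _ hx => neg_ne_zero.2 (pow_ne_zero 3 hx)

theorem inv_cube_mapsTo : Set.MapsTo (fun x : ℂ => x⁻¹ ^ 3) {0}ᶜ {0}ᶜ :=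
  fun _ hx => pow_ne_zero 3 (inv_ne_zero hx)

theorem neg_mapsTo : Set.MapsTo (fun x : ℂ => -x) {0}ᶜ {0}ᶜ := fun _ hx => neg_ne_zero.2 hx

theorem neg_inv_sq_mapsTo : Set.MapsTo (fun x : ℂ => -x⁻¹ ^ 2) {0}ᶜ {0}ᶜ :=
  fun _ hx => neg_ne_zero.2 (pow_ne_zero 2 (inv_ne_zero hx))

theorem differentiableOn_inv' : DifferentiableOn ℂ (fun x : ℂ => x⁻¹) {0}ᶜ :=
  fun _ hx => (differentiableAt_inv hx).differentiableWithinAt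

theorem differentiableOn_appellPair {q : ℂ} (hq0 : q ≠ 0) (hq : ‖q‖ < 1) :
    DifferentiableOn ℂ (appellPair q) {0}ᶜ := by
  have hq3 := norm_pow_lt_one hq three_ne_zero
  have hq30 := pow_ne_zero 3 hq0
  have h1 := (differentiableOn_appellSum hq30 hq3 (neg_ne_zero.2 (inv_ne_zero hq0))).comp
    (f := fun x : ℂ => -x ^ 3) (by fun_prop) neg_cube_mapsTo
  have h2 := (differentiableOn_appellSum hq30 hq3
    (neg_ne_zero.2 (inv_ne_zero (pow_ne_zero 2 hq0)))).comp
    (f := fun x : ℂ => -x ^ 3) (by fun_prop) neg_cube_mapsTo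
  exact (differentiableOn_inv'.mul h1).add ((differentiableOn_inv'.pow 2).mul h2)

theorem differentiableOn_theta_neg_cube {q : ℂ} (hq : ‖q‖ < 1) :
    DifferentiableOn ℂ (fun x => theta (-x ^ 3) (q ^ 3)) {0}ᶜ :=
  (differentiableOn_theta (norm_pow_lt_one hq three_ne_zero)).comp
    (f := fun x : ℂ => -x ^ 3) (by fun_prop) neg_cube_mapsTo

theorem differentiableOn_theta_neg {q : ℂ} (hq : ‖q‖ < 1) :
    DifferentiableOn ℂ (fun x => theta (-x) q) {0}ᶜ :=
  (differentiableOn_theta hq).comp (f := fun x : ℂ => -x) (by fun_prop) neg_mapsTo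

theorem theta_neg_cube_q_mul {q x : ℂ} (hx : x ≠ 0) (hq0 : q ≠ 0) (hq : ‖q‖ < 1) :
    theta (-(q * x) ^ 3) (q ^ 3) = x⁻¹ ^ 3 * theta (-x ^ 3) (q ^ 3) := by
  rw [show -(q * x) ^ 3 = q ^ 3 * -x ^ 3 by ring,
    theta_q_mul (neg_ne_zero.2 (pow_ne_zero 3 hx)) (pow_ne_zero 3 hq0)
      (norm_pow_lt_one hq three_ne_zero)]
  field_simp

theorem theta_neg_q_mul {q x : ℂ} (hx : x ≠ 0) (hq0 : q ≠ 0) (hq : ‖q‖ < 1) :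
    theta (-(q * x)) q = x⁻¹ * theta (-x) q := by
  rw [show -(q * x) = q * -x by ring, theta_q_mul (neg_ne_zero.2 hx) hq0 hq]
  field_simp

/-- The constants `w = -q⁻¹` and `w = -q⁻²` compensate the factors `q⁻¹` and `q⁻²` coming from the
powers of `x`, so both summands change sign together. -/
theorem appellPair_q_mul {q x : ℂ} (hx : x ≠ 0) (hq0 : q ≠ 0) (hq : ‖q‖ < 1) :
    appellPair q (q * x) = (x⁻¹ + x⁻¹ ^ 2) * theta (-x ^ 3) (q ^ 3) - appellPair q x := by
  have hq3 := norm_pow_lt_one hq three_ne_zero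
  have hq30 := pow_ne_zero 3 hq0
  have hx3 := neg_ne_zero.2 (pow_ne_zero 3 hx)
  rw [appellPair, appellPair, show -(q * x) ^ 3 = q ^ 3 * -x ^ 3 by ring,
    appellSum_q_mul_right hq30 hq3 hx3 (neg_ne_zero.2 (inv_ne_zero hq0)) (neg_inv_ne hq0 hq),
    appellSum_q_mul_right hq30 hq3 hx3 (neg_ne_zero.2 (inv_ne_zero (pow_ne_zero 2 hq0)))
      (neg_inv_sq_ne hq0 hq)]
  field_simp
  ring

theorem appellPair_of_cube_eq {q x : ℂ} (hq0 : q ≠ 0) (hq : ‖q‖ < 1) (hx : x ^ 3 = -1) :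
    appellPair q x * qPochInf (-q) q =
      -(x⁻¹ + x⁻¹ ^ 2) * qPochInf (q ^ 3) (q ^ 3) ^ 2 * qPochInf (-q ^ 3) (q ^ 3) := by
  have hP := qPochInf_neg_ne_zero hq
  rw [appellPair, hx, neg_neg, appellSum_neg_inv_one hq0 hq, appellSum_neg_inv_sq_one hq0 hq]
  field_simp
  ring

theorem omega_of_cube_eq {x : ℂ} (hx : x ^ 3 = -1) :
    x = -1 ∨ ((-x) ^ 2 + (-x) + 1 = 0 ∧ x⁻¹ = -(-x) ^ 2 ∧ x⁻¹ ^ 2 = -x) := by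
  by_cases h : x = -1
  · exact Or.inl h
  have h1 : (x + 1) * ((-x) ^ 2 + (-x) + 1) = 0 := by linear_combination hx
  have h2 : x⁻¹ = -(-x) ^ 2 := by
    rw [inv_eq_of_mul_eq_one_left]
    linear_combination -hx
  refine Or.inr ⟨(mul_eq_zero.1 h1).resolve_left fun h' => h (eq_neg_of_add_eq_zero_left h'),
    h2, ?_⟩
  rw [h2]; linear_combination x * hx

theorem norm_eq_one_of_pow {x : ℂ} {n : ℕ} (hn : n ≠ 0) (h : ‖x ^ n‖ = 1) : ‖x‖ = 1 := by
  rw [norm_pow] at h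
  exact (pow_eq_one_iff_of_nonneg (norm_nonneg x) hn).1 h

/-- All zeros used lie on the unit circle, where inequivalence modulo `q^ℤ` is just distinctness
because `0 < |q| < 1`. -/
theorem qInequiv_of_norm {q a b : ℂ} (hq0 : q ≠ 0) (hq : ‖q‖ < 1) (ha : ‖a‖ = 1) (hb : ‖b‖ = 1)
    (h : a ≠ b) : QInequiv q a b := by
  intro k hk
  have h1 : ‖q‖ ^ k = 1 := by
    rw [hk, norm_mul, ha, one_mul, norm_zpow] at hb
    exact hb
  obtain rfl : k = 0 :=
    (zpow_right_inj₀ (norm_pos_iff.2 hq0) hq.ne).1 (by rw [h1, zpow_zero])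
  exact h (by simpa using hk.symm)

/-- The cube roots of `-1`. -/
theorem exists_cube_roots : ∃ a b : ℂ, a ^ 3 = -1 ∧ b ^ 3 = -1 ∧ a ≠ -1 ∧ b ≠ -1 ∧ a ≠ b := by
  -- The roots are `(1 ± √-3)/2`.
  obtain ⟨s, hs⟩ := IsAlgClosed.exists_pow_nat_eq (-3 : ℂ) two_pos
  have hs0 : s ≠ 0 := by rintro rfl; norm_num at hs
  refine ⟨(1 + s) / 2, (1 - s) / 2, by linear_combination (3 + s) / 8 * hs,
    by linear_combination (3 - s) / 8 * hs, fun h => ?_, fun h => ?_, fun h => hs0 ?_⟩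
  · have : s = -3 := by linear_combination 2 * h
    rw [this] at hs; norm_num at hs
  · have : s = 3 := by linear_combination -2 * h
    rw [this] at hs; norm_num at hs
  · linear_combination h

/-- The expansion of the universal mock theta function in Appell functions, cleared of
denominators. -/
theorem umt_expansion {q x : ℂ} (hx : x ≠ 0) (hq0 : q ≠ 0) (hq : ‖q‖ < 1) :
    theta (-x ^ 3) (q ^ 3) * (x⁻¹ * (thetaUmt q x - theta x q)) + theta x q * appellPair q x
      - qPochInf q q ^ 2 * theta (-1) (q ^ 3) / theta (-1) q * theta (-x) q = 0 := by
  have hq3 := norm_pow_lt_one hq three_ne_zero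
  have hP := qPochInf_neg_ne_zero hq
  have hJ := qPochInf_ne_zero_of_norm_lt hq hq
  set c := qPochInf q q ^ 2 * theta (-1) (q ^ 3) / theta (-1) q with hc
  have hc' : c * qPochInf (-q) q ^ 2 =
      qPochInf q q * qPochInf (-q ^ 3) (q ^ 3) ^ 2 * qPochInf (q ^ 3) (q ^ 3) := by
    rw [hc, theta_neg_one hq, theta_neg_one hq3]
    field_simp
  set E : ℂ → ℂ := fun x => theta (-x ^ 3) (q ^ 3) * (x⁻¹ * (thetaUmt q x - theta x q))
    + theta x q * appellPair q x - c * theta (-x) q with hE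
  have hEd : DifferentiableOn ℂ E {0}ᶜ :=
    (((differentiableOn_theta_neg_cube hq).mul (differentiableOn_inv'.mul
      ((differentiableOn_thetaUmt hq).sub (differentiableOn_theta hq)))).add
      ((differentiableOn_theta hq).mul (differentiableOn_appellPair hq0 hq))).sub
      ((differentiableOn_theta_neg hq).const_mul c)
  have hEq : ∀ x, x ≠ 0 → E (q * x) = 1 * x ^ (-(1 : ℤ)) * E x := by
    intro x hx
    have h1 : thetaUmt q (q * x) = q * x ^ 2 * thetaUmt q x - x⁻¹ * (1 - q * x ^ 2) * theta x q := by
      have := thetaUmt_q_mul hq hq0 hx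
      generalize thetaUmt q (q * x) = G at this ⊢
      apply mul_left_cancel₀ hx
      field_simp
      linear_combination -this
    simp only [hE]
    rw [h1, theta_neg_cube_q_mul hx hq0 hq, theta_neg_q_mul hx hq0 hq, appellPair_q_mul hx hq0 hq,
      theta_q_mul hx hq0 hq, zpow_neg_one]
    field_simp
    ring
  have hzero : ∀ a : ℂ, a ^ 3 = -1 → E a = 0 := by
    intro a ha
    have hN := appellPair_of_cube_eq hq0 hq ha
    simp only [hE]
    -- Since `-a³ = 1`, the term containing `g` drops out, leaving an identity between explicit
    -- products. For nonreal `a` it holds modulo `a² - a + 1 = 0`.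
    rw [ha, neg_neg, theta_one hq3, zero_mul, zero_add]
    rcases omega_of_cube_eq ha with rfl | ⟨hω, hi, hi2⟩
    · have : appellPair q (-1) = 0 := by
        refine (mul_eq_zero.1 (hN.trans ?_)).resolve_right hP
        norm_num
      rw [this, neg_neg, theta_one hq]
      ring
    · have h1 := theta_omega hq hω
      have h2 := theta_neg_omega hq hω
      rw [hi2, hi] at hN
      rw [neg_neg] at h2
      refine (mul_eq_zero.1 ?_).resolve_right (pow_ne_zero 2 hP)
      linear_combination (appellPair q a * qPochInf (-q) q) * h2
        + (1 - a) * qPochInf (-q ^ 3) (q ^ 3) * qPochInf q q * hN - theta (-a) q * hc'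
        - (qPochInf q q * qPochInf (-q ^ 3) (q ^ 3) ^ 2 * qPochInf (q ^ 3) (q ^ 3)) * h1
        + (-a - 1) * qPochInf q q * qPochInf (q ^ 3) (q ^ 3) ^ 2 * qPochInf (-q ^ 3) (q ^ 3) ^ 2 * hω
  obtain ⟨a, b, ha, hb, ha1, hb1, hab⟩ := exists_cube_roots
  have hn : ∀ a : ℂ, a ^ 3 = -1 → ‖a‖ = 1 := fun a ha =>
    norm_eq_one_of_pow three_ne_zero (by rw [ha]; simp)
  refine eq_zero_of_zeros hq0 hq [a, b] E 1 1 hEd one_ne_zero hEq ?_ ?_ ?_ (by simp) x hx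
  · intro y hy
    simp only [List.mem_cons, List.not_mem_nil, or_false] at hy
    rcases hy with rfl | rfl
    · exact norm_ne_zero_iff.1 (by rw [hn _ ha]; exact one_ne_zero)
    · exact norm_ne_zero_iff.1 (by rw [hn _ hb]; exact one_ne_zero)
  · simpa using qInequiv_of_norm hq0 hq (hn _ ha) (hn _ hb) hab
  · intro y hy
    simp only [List.mem_cons, List.not_mem_nil, or_false] at hy
    rcases hy with rfl | rfl
    · exact hzero _ ha
    · exact hzero _ hb

/-- The holomorphic function `Θ(w;q) ∑ q^{r(r-1)/2} / (1 - q^r w)`. -/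
def appellNegOne (q w : ℂ) : ℂ :=
  thetaMulSum (fun r => (-1) ^ r * q ^ binom2 r * (-1) ^ r) q w

theorem differentiableOn_appellNegOne {q : ℂ} (hq0 : q ≠ 0) (hq : ‖q‖ < 1) :
    DifferentiableOn ℂ (appellNegOne q) {0}ᶜ :=
  differentiableOn_thetaMulSum hq0 hq (summable_norm_thetaTerm (neg_ne_zero.2 one_ne_zero) hq0 hq)

theorem appellNegOne_eq {q w : ℂ} (hq0 : q ≠ 0) (hq : ‖q‖ < 1) (hw : w ≠ 0)
    (h : ∀ k : ℤ, w ≠ q ^ k) : appellNegOne q w = theta w q * appellSum w (-1) q :=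
  thetaMulSum_eq hq0 hq _ hw h

theorem appellNegOne_q_mul {q w : ℂ} (hq0 : q ≠ 0) (hq : ‖q‖ < 1) (hw : w ≠ 0) :
    appellNegOne q (q * w) = -q * appellNegOne q w - w⁻¹ * theta (-1) q * theta w q := by
  have hd := (differentiableOn_appellNegOne hq0 hq).continuousOn
  have hmaps : Set.MapsTo (fun x => q * x) ({0}ᶜ : Set ℂ) {0}ᶜ := fun x hx => mul_ne_zero hq0 hx
  refine eqOn_of_countable (f := fun w => appellNegOne q (q * w))
    (g := fun w => -q * appellNegOne q w - w⁻¹ * theta (-1) q * theta w q)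
    (S := Set.range fun k : ℤ => q ^ k) (Set.countable_range _)
    (hd.comp (by fun_prop) hmaps) ((hd.const_mul _).sub ((differentiableOn_inv'.continuousOn.mul
      continuousOn_const).mul (differentiableOn_theta hq).continuousOn)) (fun y hy hyS => ?_) hw
  have hy1 : ∀ k : ℤ, y ≠ q ^ k := fun k hk => hyS ⟨k, hk.symm⟩
  have hy2 : ∀ k : ℤ, q * y ≠ q ^ k := fun k hk => hy1 (k - 1) (by
    rw [zpow_sub_one₀ hq0, ← hk]; field_simp)
  rw [appellNegOne_eq hq0 hq hy hy1, appellNegOne_eq hq0 hq (mul_ne_zero hq0 hy) hy2,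
    appellSum_q_mul_left hq0 hq (neg_ne_zero.2 one_ne_zero) hy hy1, theta_q_mul hy hq0 hq]
  field_simp
  ring

theorem appellNegOne_one {q : ℂ} (hq0 : q ≠ 0) (hq : ‖q‖ < 1) :
    appellNegOne q 1 = qPochInf q q ^ 3 := by
  rw [appellNegOne, thetaMulSum_one hq0 hq]
  simp

/-- The expansion of the double sum in Appell functions, cleared of denominators. -/
theorem hecke_expansion {q x : ℂ} (hx : x ≠ 0) (hq0 : q ≠ 0) (hq : ‖q‖ < 1) :
    theta (-x⁻¹ ^ 2) q * (theta (-x ^ 3) (q ^ 3) * hecke 1 2 3 (x⁻¹ * q ^ 2) (q ^ 3) q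
        - qPochInf q q * appellPair q x)
      + (theta (-1) q)⁻¹ *
        (x⁻¹ * theta x q * theta (-x ^ 3) (q ^ 3) * appellNegOne q (-x⁻¹ ^ 2))
      + qPochInf (q ^ 2) (q ^ 2) ^ 3 * theta q (q ^ 2) / (theta (-1) (q ^ 2) * theta (-q) (q ^ 2)) *
        (theta (-x) q * theta (x⁻¹ ^ 3) (q ^ 3)) = 0 := by
  have hq3 := norm_pow_lt_one hq three_ne_zero
  have hq30 := pow_ne_zero 3 hq0
  have hP := qPochInf_neg_ne_zero hq
  have hJ := qPochInf_ne_zero_of_norm_lt hq hq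
  have hθ1 := theta_neg_one_ne_zero hq
  rw [thetaConstant_eq hq0 hq]
  set c := qPochInf q q ^ 2 / (2 * qPochInf (-q) q ^ 2) with hc
  have hc' : 2 * c * qPochInf (-q) q ^ 2 = qPochInf q q ^ 2 := by
    rw [hc]
    field_simp
  set E : ℂ → ℂ := fun x =>
    theta (-x⁻¹ ^ 2) q * (theta (-x ^ 3) (q ^ 3) * hecke 1 2 3 (x⁻¹ * q ^ 2) (q ^ 3) q
        - qPochInf q q * appellPair q x)
      + (theta (-1) q)⁻¹ *
        (x⁻¹ * theta x q * theta (-x ^ 3) (q ^ 3) * appellNegOne q (-x⁻¹ ^ 2))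
      + c * (theta (-x) q * theta (x⁻¹ ^ 3) (q ^ 3)) with hE
  have hwd : DifferentiableOn ℂ (fun x : ℂ => -x⁻¹ ^ 2) {0}ᶜ := (differentiableOn_inv'.pow 2).neg
  have hEd : DifferentiableOn ℂ E {0}ᶜ := by
    have h1 := (differentiableOn_theta hq).comp hwd neg_inv_sq_mapsTo
    have h2 := (differentiableOn_appellNegOne hq0 hq).comp hwd neg_inv_sq_mapsTo
    have h3 := (differentiableOn_theta hq3).comp (differentiableOn_inv'.pow 3) inv_cube_mapsTo
    exact ((h1.mul (((differentiableOn_theta_neg_cube hq).mul (differentiableOn_hecke hq0 hq)).sub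
      ((differentiableOn_appellPair hq0 hq).const_mul _))).add
      ((((differentiableOn_inv'.mul (differentiableOn_theta hq)).mul
        (differentiableOn_theta_neg_cube hq)).mul h2).const_mul _)).add
      (((differentiableOn_theta_neg hq).mul h3).const_mul c)
  have hEq : ∀ x, x ≠ 0 → E (q * x) = -(q ^ 3)⁻¹ * x ^ (-(4 : ℤ)) * E x := by
    intro x hx
    have hw0 : -x⁻¹ ^ 2 ≠ 0 := neg_ne_zero.2 (pow_ne_zero 2 (inv_ne_zero hx))
    set u := -(q * x)⁻¹ ^ 2 with hu
    have hu0 : u ≠ 0 := neg_ne_zero.2 (pow_ne_zero 2 (inv_ne_zero (mul_ne_zero hq0 hx)))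
    have hqu0 := mul_ne_zero hq0 hu0
    -- Passing from `x` to `qx` divides `-x⁻²` by `q²`, so the functional equations in `w` are
    -- applied twice starting from the new value `u`.
    have hw : -x⁻¹ ^ 2 = q * (q * u) := by rw [hu]; field_simp
    have h1 : theta (-x⁻¹ ^ 2) q = q⁻¹ * u⁻¹ ^ 2 * theta u q := by
      rw [hw, theta_q_mul hqu0 hq0 hq, theta_q_mul hu0 hq0 hq]
      field_simp
    have h2 : appellNegOne q (-x⁻¹ ^ 2) = q ^ 2 * appellNegOne q u +
        (q * u⁻¹ + q⁻¹ * u⁻¹ ^ 2) * theta (-1) q * theta u q := by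
      rw [hw, appellNegOne_q_mul hq0 hq hqu0, appellNegOne_q_mul hq0 hq hu0,
        theta_q_mul hu0 hq0 hq]
      field_simp
      ring
    have h3 : theta ((q * x)⁻¹ ^ 3) (q ^ 3) = -(q ^ 3)⁻¹ * x⁻¹ ^ 3 * theta (x⁻¹ ^ 3) (q ^ 3) := by
      have hx3 : (q * x)⁻¹ ^ 3 ≠ 0 := pow_ne_zero 3 (inv_ne_zero (mul_ne_zero hq0 hx))
      have h := theta_q_mul hx3 hq30 hq3
      rw [show q ^ 3 * (q * x)⁻¹ ^ 3 = x⁻¹ ^ 3 by field_simp] at h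
      rw [h]
      field_simp
    have h4 : u⁻¹ = -(q * x) ^ 2 := by rw [hu]; field_simp
    simp only [hE]
    rw [← hu, h1, h2, h3, h4, theta_neg_cube_q_mul hx hq0 hq, theta_neg_q_mul hx hq0 hq,
      appellPair_q_mul hx hq0 hq, theta_q_mul hx hq0 hq, hecke_q_mul hx hq0 hq, zpow_neg,
      show x ^ (4 : ℤ) = x ^ 4 by norm_cast]
    generalize hecke 1 2 3 (x⁻¹ * q ^ 2) (q ^ 3) q = F
    generalize theta (x⁻¹ ^ 3) (q ^ 3) = T
    field_simp
    ring
  have hzero : ∀ a : ℂ, a ^ 3 = -1 → E a = 0 := by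
    intro a ha
    have hN := appellPair_of_cube_eq hq0 hq ha
    simp only [hE]
    rw [ha, neg_neg, theta_one hq3, inv_pow a 3, ha]
    rcases omega_of_cube_eq ha with rfl | ⟨hω, hi, hi2⟩
    · have : appellPair q (-1) = 0 := by
        refine (mul_eq_zero.1 (hN.trans ?_)).resolve_right hP
        norm_num
      rw [this, neg_neg, theta_one hq]
      ring
    · have h1 := theta_omega hq hω
      have h2 := theta_neg_omega hq hω
      rw [hi2, hi] at hN
      rw [neg_neg] at h2
      rw [hi2, neg_neg, inv_neg, inv_one, theta_neg_one hq3]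
      refine (mul_eq_zero.1 ?_).resolve_right (pow_ne_zero 2 hP)
      linear_combination (-qPochInf q q * (appellPair q a * qPochInf (-q) q)) * h2
        - qPochInf q q * (1 - a) * qPochInf (-q ^ 3) (q ^ 3) * qPochInf q q * hN
        + qPochInf (-q ^ 3) (q ^ 3) ^ 2 * qPochInf (q ^ 3) (q ^ 3) * theta (-a) q * hc'
        + (qPochInf q q ^ 2 * qPochInf (-q ^ 3) (q ^ 3) ^ 2 * qPochInf (q ^ 3) (q ^ 3)) * h1
        - (-a - 1) * qPochInf q q ^ 2 * qPochInf (q ^ 3) (q ^ 3) ^ 2 *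
          qPochInf (-q ^ 3) (q ^ 3) ^ 2 * hω
  have hzero' : ∀ a : ℂ, a ^ 2 = -1 → E a = 0 := by
    intro a ha
    have ha0 : a ≠ 0 := by rintro rfl; norm_num at ha
    have hi : a⁻¹ = -a := by
      rw [inv_eq_of_mul_eq_one_left]; linear_combination -ha
    have h1 := theta_inv ha0 hq0 hq
    rw [hi] at h1
    simp only [hE]
    -- At `a² = -1` one has `-a⁻² = 1`: the factor `Θ(-x⁻²;q)` removes the double sum and the pair,
    -- and only the residue `(q)_∞³` is left against the theta quotient.
    rw [hi, show -(-a) ^ 2 = 1 by linear_combination -ha, show -a ^ 3 = a by linear_combination -a * ha,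
      show (-a) ^ 3 = a by linear_combination -a * ha, theta_one hq, appellNegOne_one hq0 hq, h1,
      theta_neg_one hq]
    have : (2 * qPochInf (-q) q ^ 2 * qPochInf q q)⁻¹ * qPochInf q q ^ 3 = c := by
      rw [hc]; field_simp
    linear_combination (-a * theta a q * theta a (q ^ 3)) * this
  obtain ⟨a, b, ha, hb, ha1, hb1, hab⟩ := exists_cube_roots
  have hn : ∀ a : ℂ, a ^ 3 = -1 → ‖a‖ = 1 := fun a ha =>
    norm_eq_one_of_pow three_ne_zero (by rw [ha]; simp)
  have hI : ∀ a : ℂ, a ^ 3 = -1 → a ^ 2 ≠ -1 := by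
    intro a ha ha'
    have h1 : a = 1 := by linear_combination -ha + a * ha'
    rw [h1] at ha
    norm_num at ha
  have hI2 : ∀ s : ℂ, s = Complex.I ∨ s = -Complex.I → s ^ 2 = -1 := by
    rintro s (rfl | rfl) <;> simp
  have hneg : (-1 : ℂ) ^ 3 = -1 := by norm_num
  have hall : ∀ y ∈ [-1, a, b, Complex.I, -Complex.I], ‖y‖ = 1 ∧ E y = 0 := by
    intro y hy
    simp only [List.mem_cons, List.not_mem_nil, or_false] at hy
    rcases hy with rfl | rfl | rfl | hy
    · exact ⟨hn _ hneg, hzero _ hneg⟩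
    · exact ⟨hn _ ha, hzero _ ha⟩
    · exact ⟨hn _ hb, hzero _ hb⟩
    · exact ⟨norm_eq_one_of_pow two_ne_zero (by rw [hI2 y hy]; simp), hzero' _ (hI2 y hy)⟩
  have hnd : [-1, a, b, Complex.I, -Complex.I].Nodup := by
    have hne : ∀ a : ℂ, a ^ 3 = -1 → a ≠ Complex.I ∧ a ≠ -Complex.I := fun a ha =>
      ⟨fun h => hI a ha (hI2 a (Or.inl h)), fun h => hI a ha (hI2 a (Or.inr h))⟩
    have hII : Complex.I ≠ -Complex.I := fun h =>
      Complex.I_ne_zero (self_eq_neg.1 h)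
    simp only [List.nodup_cons, List.mem_cons, List.not_mem_nil, or_false, not_or]
    exact ⟨⟨ha1.symm, hb1.symm, hne _ hneg⟩, ⟨hab, hne _ ha⟩, hne _ hb, hII, not_false,
      List.nodup_nil⟩
  refine eq_zero_of_zeros hq0 hq [-1, a, b, Complex.I, -Complex.I] E _ 4 hEd
    (neg_ne_zero.2 (inv_ne_zero hq30)) hEq ?_ ?_ (fun y hy => (hall y hy).2) (by simp) x hx
  · intro y hy
    exact norm_ne_zero_iff.1 (by rw [(hall y hy).1]; exact one_ne_zero)
  · exact List.Pairwise.imp_of_mem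
      (fun hy hz h => qInequiv_of_norm hq0 hq (hall _ hy).1 (hall _ hz).1 h) hnd

/-! ### The expansions with denominators -/

theorem genericDomain_ne {x q : ℂ} (h : (x, q) ∈ genericDomain) :
    q ≠ 0 ∧ ‖q‖ < 1 ∧ x ≠ 0 ∧ (∀ k : ℤ, -x ^ 3 ≠ (q ^ 3) ^ k) ∧ ∀ k : ℤ, -x⁻¹ ^ 2 ≠ q ^ k := by
  obtain ⟨h0, h1, hx, h3, h2⟩ := h
  simp only at h0 h1 hx h2 h3
  refine ⟨norm_pos_iff.1 h0, h1, hx, fun k hk => h3 k ?_, fun k hk => h2 (-k) ?_⟩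
  · rw [zpow_mul, show q ^ (3 : ℤ) = q ^ 3 by norm_cast, ← hk, neg_neg]
  · rw [zpow_neg, ← hk, inv_pow, inv_neg, inv_inv, neg_neg]

theorem appell_first_eq {x q : ℂ} (hx : x ≠ 0) (hq0 : q ≠ 0) :
    x⁻¹ ^ 3 * q ^ 2 * -x ^ 3 = q ^ 3 * -q⁻¹ := by field_simp

theorem appell_second_eq {x q : ℂ} (hx : x ≠ 0) (hq0 : q ≠ 0) :
    x⁻¹ ^ 3 * q * -x ^ 3 = q ^ 3 * -(q ^ 2)⁻¹ := by field_simp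

theorem appell_third_eq (x q : ℂ) : q * x⁻¹ ^ 2 * -1 = q * -x⁻¹ ^ 2 := by ring

theorem appellPair_eq {x q : ℂ} (h : (x, q) ∈ genericDomain) :
    appellPair q x = theta (-x ^ 3) (q ^ 3) * (x⁻¹ * appell (x⁻¹ ^ 3 * q ^ 2) (-x ^ 3) (q ^ 3)
      + x⁻¹ ^ 2 * appell (x⁻¹ ^ 3 * q) (-x ^ 3) (q ^ 3)) := by
  obtain ⟨hq0, hq, hx, h3, -⟩ := genericDomain_ne h
  have hq30 := pow_ne_zero 3 hq0
  have hθ := theta_ne_zero (norm_pow_lt_one hq three_ne_zero) h3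
  rw [appell_eq hq30 (appell_first_eq hx hq0), appell_eq hq30 (appell_second_eq hx hq0), appellPair]
  field_simp

theorem hecke_eq {x q : ℂ} (h : (x, q) ∈ genericDomain) :
    hecke 1 2 3 (x⁻¹ * q ^ 2) (q ^ 3) q =
      x⁻¹ * appell (x⁻¹ ^ 3 * q ^ 2) (-x ^ 3) (q ^ 3) * qPochInf q q
      + x⁻¹ ^ 2 * appell (x⁻¹ ^ 3 * q) (-x ^ 3) (q ^ 3) * qPochInf q q
      - x⁻¹ * theta x q * appell (q * x⁻¹ ^ 2) (-1) q
      - qPochInf (q ^ 2) (q ^ 2) ^ 3 * theta q (q ^ 2) * theta (-x) q * theta (x⁻¹ ^ 3) (q ^ 3)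
        / (theta (-1) (q ^ 2) * theta (-q) (q ^ 2)
          * theta (-x ^ 3) (q ^ 3) * theta (-x⁻¹ ^ 2) q) := by
  have hN := appellPair_eq h
  obtain ⟨hq0, hq, hx, h3, h2⟩ := genericDomain_ne h
  have hθ3 := theta_ne_zero (norm_pow_lt_one hq three_ne_zero) h3
  have hθ2 := theta_ne_zero hq h2
  have hθ1 := theta_neg_one_ne_zero hq
  have hw : -x⁻¹ ^ 2 ≠ 0 := neg_ne_zero.2 (pow_ne_zero 2 (inv_ne_zero hx))
  have hE := hecke_expansion hx hq0 hq
  rw [hN, appellNegOne_eq hq0 hq hw h2] at hE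
  rw [appell_eq hq0 (appell_third_eq x q)]
  rw [mul_assoc (theta (-1) (q ^ 2) * theta (-q) (q ^ 2)), mul_assoc (_ * theta q (q ^ 2)),
    mul_div_mul_comm (_ * theta q (q ^ 2))]
  generalize qPochInf (q ^ 2) (q ^ 2) ^ 3 * theta q (q ^ 2) /
    (theta (-1) (q ^ 2) * theta (-q) (q ^ 2)) = c at *
  generalize hecke 1 2 3 (x⁻¹ * q ^ 2) (q ^ 3) q = F at *
  generalize appell (x⁻¹ ^ 3 * q ^ 2) (-x ^ 3) (q ^ 3) = m1 at *
  generalize appell (x⁻¹ ^ 3 * q) (-x ^ 3) (q ^ 3) = m2 at *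
  generalize appellSum (-x⁻¹ ^ 2) (-1) q = S at *
  generalize theta (-x⁻¹ ^ 2) q = A at *
  generalize theta (-x ^ 3) (q ^ 3) = B at *
  generalize theta (x⁻¹ ^ 3) (q ^ 3) = T at *
  field_simp at hE ⊢
  linear_combination hE

theorem umt_eq {x q : ℂ} (h : (x, q) ∈ genericDomain) (hθ : theta x q ≠ 0) :
    umt x q = -(x⁻¹ * appell (x⁻¹ ^ 3 * q ^ 2) (-x ^ 3) (q ^ 3)
      + x⁻¹ ^ 2 * appell (x⁻¹ ^ 3 * q) (-x ^ 3) (q ^ 3))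
      + qPochInf q q ^ 2 * theta (-x) q * theta (-1) (q ^ 3) /
        (theta x q * theta (-1) q * theta (-x ^ 3) (q ^ 3)) := by
  have hN := appellPair_eq h
  obtain ⟨hq0, hq, hx, h3, h2⟩ := genericDomain_ne h
  have hθ3 := theta_ne_zero (norm_pow_lt_one hq three_ne_zero) h3
  have hθ1 := theta_neg_one_ne_zero hq
  have hE := umt_expansion hx hq0 hq
  rw [← theta_mul_umt hq hθ, hN] at hE
  generalize appell (x⁻¹ ^ 3 * q ^ 2) (-x ^ 3) (q ^ 3) = m1 at *
  generalize appell (x⁻¹ ^ 3 * q) (-x ^ 3) (q ^ 3) = m2 at *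
  field_simp at hE ⊢
  linear_combination hE

/-- The theta quotient in the expansion of the double sum. -/
def heckeQuotient : ThetaQuotient where
  coeff := -1
  i := 0
  j := 0
  -- The repeated factor is `Θ(q²;q⁶) = (q²;q²)_∞`.
  num := [⟨1, 0, 2, 6, by norm_num⟩, ⟨1, 0, 2, 6, by norm_num⟩, ⟨1, 0, 2, 6, by norm_num⟩,
    ⟨1, 0, 1, 2, by norm_num⟩, ⟨-1, 1, 0, 1, by norm_num⟩, ⟨1, -3, 0, 3, by norm_num⟩]
  den := [⟨-1, 0, 0, 2, by norm_num⟩, ⟨-1, 0, 1, 2, by norm_num⟩, ⟨-1, 3, 0, 3, by norm_num⟩,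
    ⟨-1, -2, 0, 1, by norm_num⟩]

/-- The theta quotient in the expansion of the universal mock theta function, multiplied by
`(q;q)_∞ = Θ(q;q³)`. -/
def umtQuotient : ThetaQuotient where
  coeff := 1
  i := 0
  j := 0
  -- Two copies of `Θ(q;q³)` come from the expansion of `g`, the third from its multiplier `(q)_∞`.
  num := [⟨1, 0, 1, 3, by norm_num⟩, ⟨1, 0, 1, 3, by norm_num⟩, ⟨1, 0, 1, 3, by norm_num⟩,
    ⟨-1, 1, 0, 1, by norm_num⟩, ⟨-1, 0, 0, 3, by norm_num⟩]
  den := [⟨1, 1, 0, 1, by norm_num⟩, ⟨-1, 0, 0, 1, by norm_num⟩, ⟨-1, 3, 0, 3, by norm_num⟩]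

theorem equivModTheta_hecke_umt :
    EquivModTheta genericDomainUmt
      (fun x q => hecke 1 2 3 (x⁻¹ * q ^ 2) (q ^ 3) q)
      (fun x q => -qPochInf q q * umt x q - x⁻¹ * theta x q * appell (q * x⁻¹ ^ 2) (-1) q) := by
  refine ⟨[heckeQuotient, umtQuotient], fun x q hxq => ?_⟩
  obtain ⟨h, hk⟩ := hxq
  simp only at hk
  obtain ⟨hq0, hq, hx, h3, h2⟩ := genericDomain_ne h
  have hq2 := norm_pow_lt_one hq two_ne_zero
  have hq3 := norm_pow_lt_one hq three_ne_zero
  have hθ3 := theta_ne_zero hq3 h3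
  have hθ2 := theta_ne_zero hq h2
  have hθ := theta_ne_zero hq hk
  have hθ1 := theta_neg_one_ne_zero hq
  have hθ12 := theta_neg_one_ne_zero hq2
  have hθq : theta (-q) (q ^ 2) ≠ 0 := by
    rw [theta_neg_q_sq hq0]
    exact mul_ne_zero (pow_ne_zero 2 (qPochInf_ne_zero_of_norm_lt hq2 (by rwa [norm_neg])))
      (qPochInf_ne_zero_of_norm_lt hq2 hq2)
  have e3 : x ^ (-3 : ℤ) = x⁻¹ ^ 3 := by rw [zpow_neg, inv_pow]; norm_cast
  have e2 : x ^ (-2 : ℤ) = x⁻¹ ^ 2 := by rw [zpow_neg, inv_pow]; norm_cast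
  have e3' : x ^ (3 : ℤ) = x ^ 3 := by norm_cast
  have e2' : q ^ (2 : ℤ) = q ^ 2 := by norm_cast
  have hJ := theta_q_cube hq0 hq
  have hJ2 := theta_q_cube (pow_ne_zero 2 hq0) hq2
  rw [← pow_mul] at hJ2
  constructor
  · simp only [List.mem_cons, List.not_mem_nil, or_false, forall_eq_or_imp, forall_eq,
      heckeQuotient, umtQuotient, ThetaFactor.eval, Units.val_neg, Units.val_one, Int.cast_neg,
      Int.cast_one, zpow_zero, zpow_one, mul_one, one_mul, pow_one, neg_mul, e3', e2]
    exact ⟨⟨hθ12, hθq, hθ3, hθ2⟩, hθ, hθ1, hθ3⟩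
  · simp only [heckeQuotient, umtQuotient, ThetaQuotient.eval, ThetaFactor.eval, List.map_cons,
      List.map_nil, List.prod_cons, List.prod_nil, List.sum_cons, List.sum_nil,
      Units.val_neg, Units.val_one, Int.cast_neg, Int.cast_one, zpow_zero, zpow_one, mul_one,
      one_mul, pow_one, neg_mul, e3', e2, e3, e2', hJ, hJ2]
    rw [hecke_eq h, umt_eq h hθ]
    field_simp
    ring

end MockTheta

end
theorem corollary7p2 :
    -- the identity, together with the convergence of all series in it
    (∀ x q : ℂ, (x, q) ∈ MockTheta.genericDomain →
      Summable (MockTheta.heckeTerm 1 2 3 (x⁻¹ * q ^ 2) (q ^ 3) q) ∧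
      Summable (MockTheta.appellTerm (x⁻¹ ^ 3 * q ^ 2) (-x ^ 3) (q ^ 3)) ∧
      Summable (MockTheta.appellTerm (x⁻¹ ^ 3 * q) (-x ^ 3) (q ^ 3)) ∧
      Summable (MockTheta.appellTerm (q * x⁻¹ ^ 2) (-1) q) ∧
      MockTheta.hecke 1 2 3 (x⁻¹ * q ^ 2) (q ^ 3) q =
        x⁻¹ * MockTheta.appell (x⁻¹ ^ 3 * q ^ 2) (-x ^ 3) (q ^ 3) * MockTheta.qPochInf q q
        + x⁻¹ ^ 2 * MockTheta.appell (x⁻¹ ^ 3 * q) (-x ^ 3) (q ^ 3) * MockTheta.qPochInf q q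
        - x⁻¹ * MockTheta.theta x q * MockTheta.appell (q * x⁻¹ ^ 2) (-1) q
        - MockTheta.qPochInf (q ^ 2) (q ^ 2) ^ 3 * MockTheta.theta q (q ^ 2)
            * MockTheta.theta (-x) q * MockTheta.theta (x⁻¹ ^ 3) (q ^ 3)
          / (MockTheta.theta (-1) (q ^ 2) * MockTheta.theta (-q) (q ^ 2)
            * MockTheta.theta (-x ^ 3) (q ^ 3) * MockTheta.theta (-x⁻¹ ^ 2) q)) ∧
    -- the equivalence modulo theta functions
    (∀ x q : ℂ, (x, q) ∈ MockTheta.genericDomainUmt → Summable (MockTheta.umtTerm x q)) ∧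
    MockTheta.EquivModTheta MockTheta.genericDomainUmt
      (fun x q => MockTheta.hecke 1 2 3 (x⁻¹ * q ^ 2) (q ^ 3) q)
      (fun x q => -MockTheta.qPochInf q q * MockTheta.umt x q
        - x⁻¹ * MockTheta.theta x q * MockTheta.appell (q * x⁻¹ ^ 2) (-1) q) := by
  refine ⟨fun x q h => ?_, fun x q h => ?_, MockTheta.equivModTheta_hecke_umt⟩
  · obtain ⟨hq0, hq, hx, -, -⟩ := MockTheta.genericDomain_ne h
    have hq3 := MockTheta.norm_pow_lt_one hq three_ne_zero
    have hq30 := pow_ne_zero 3 hq0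
    have hx3 := neg_ne_zero.2 (pow_ne_zero 3 hx)
    exact ⟨MockTheta.summable_heckeTerm hx hq0 hq,
      MockTheta.summable_appellTerm hq30 hq3 (MockTheta.appell_first_eq hx hq0) hx3
        (neg_ne_zero.2 (inv_ne_zero hq0)),
      MockTheta.summable_appellTerm hq30 hq3 (MockTheta.appell_second_eq hx hq0) hx3
        (neg_ne_zero.2 (inv_ne_zero (pow_ne_zero 2 hq0))),
      MockTheta.summable_appellTerm hq0 hq (MockTheta.appell_third_eq x q)
        (neg_ne_zero.2 one_ne_zero) (neg_ne_zero.2 (pow_ne_zero 2 (inv_ne_zero hx))),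
      MockTheta.hecke_eq h⟩
  · obtain ⟨-, hq, hx, -, -⟩ := MockTheta.genericDomain_ne h.1
    exact MockTheta.summable_umtTerm hq hx (MockTheta.theta_ne_zero hq h.2)
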